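/- Let $n\ge 1$, $k_1=\dots=k_n=3$, $\mathbf k=(k_1,\dots,k_n)$ and $K=k_1+\dots+k_n=3n$. A *Stirling permutation* of the multiset $\{1^{k_1},\dots,n^{k_n}\}$ is an arrangement $\sigma(1)\cdots\sigma(K)$ of its elements such that $\sigma(i)=\sigma(j)$ and $i<s<j$ imply $\sigma(s)\ge\sigma(i)$. An index $i$ is a *descent* of $\sigma$ if $i=K$, or $i<K$ and $\sigma(i)>\sigma(i+1)$. Let $A_{\mathbf k,i}$ be the number of Stirling permutations of this multiset with exactly $i$ descents, and define $B_{\mathbf k}(m)$, $b_{\mathbf k}(m)$ for integers $m\ge 0$ by $$\frac{\sum_{i=1}^{n}A_{\mathbf k,i}x^i}{(1-x)^{K+1}}=\sum_{m\ge 0}B_{\mathbf k}(m)x^m,\qquad \frac{\sum_{i=K-n+1}^{K}A_{\mathbf k,K+1-i}x^i}{(1-x)^{K+1}}=\sum_{m\ge 0}b_{\mathbf k}(m)x^m .$$ Write $[N]=\{1,\dots,N\}$. For a family $\mathcal F$ of nonempty sets of positive integers let $\min(\mathcal F)$ be the set of the minimal elements of its members, and write $a\sim_{\mathcal F}b$ if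 some member of $\mathcal F$ contains both $a$ and $b$. A family $\mathcal F$ of nonempty subsets of $[N+1]$ is *segmented* if for all $a<b<c$ in $[N+1]$, $a\sim_{\mathcal F}c$ implies $b\in\min(\mathcal F)$. Let $\mathrm{lmin}(\sigma)$ be the set of left-to-right minima (values) of a permutation $\sigma$ written in one-line notation. Then for every integer $m\ge 0$: 1. $B_{\mathbf k}(m)$ is the number of ordered pairs $(\pi_0,\pi_1)$ such that, with $N=n+m$, $\pi_1$ is a partition of $[N]$ into $m$ blocks, $\pi_0$ is a segmented partition of a subset of $[N+1]$ into $m$ blocks, $\min(\pi_0)=\min(\pi_1)$, and $x\sim_{\pi_0}1$ for $x=\min([N]\setminus\min(\pi_1))$. 2. $b_{\mathbf k}(m)$ is the number of ordered pairs $(\sigma_0,\sigma_1)$ such that, with $N=m$, $\sigma_1$ is a permutation of $[N]$ with exactly $m-n$ left-to-right minima, $\sigma_0$ is a segmented partition of $[N+1]$ into $m-n$ blocks, $\min(\sigma_0)=\mathrm{lmin}(\sigma_1)$, and $x\sim_{\sigma_0}1$ for $x=\min([N]\setminus\mathrm{lmin}(\sigma_1))$. (This number is $0$ if $m<n$.)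 -/

import Mathlib

/-! ### Stirling permutations of a multiset and the Stirling polynomials -/

/-- `K = k₁ + ⋯ + kₙ`, the size of the multiset `{1 ^ k₁, …, n ^ kₙ}`. -/
def multisetSize {n : ℕ} (k : Fin n → ℕ) : ℕ := ∑ j, k j

/-- The word `w` of length `K` is a Stirling permutation of the multiset in which the letter `j`
has `k j` copies: every letter occurs the right number of times, and every letter lying between
two copies of a letter `j` is at least `j`. -/
def IsStirlingPerm {n : ℕ} (k : Fin n → ℕ) (w : Fin (multisetSize k) → Fin n) : Prop :=
  (∀ j : Fin n, (Finset.univ.filter fun p => w p = j).card = k j) ∧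
    ∀ p s q, p < s → s < q → w p = w q → w p ≤ w s

/-- The position `p` (counted from `0`) is a descent of the word `w`: it is the last position, or
the letter there is larger than the next one. -/
def IsDescent {n K : ℕ} (w : Fin K → Fin n) (p : Fin K) : Prop :=
  (p : ℕ) + 1 = K ∨ ∃ q : Fin K, (q : ℕ) = p + 1 ∧ w q < w p

/-- The Eulerian number `A_{k, i}`: the number of Stirling permutations with `i` descents. -/
noncomputable def eulerianNumber {n : ℕ} (k : Fin n → ℕ) (i : ℕ) : ℕ :=
  {w : Fin (multisetSize k) → Fin n |
    IsStirlingPerm k w ∧ {p | IsDescent w p}.ncard = i}.ncard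

/-- `G_k(x) = (∑_{i = 1}^{n} A_{k, i} x ^ i) / (1 - x) ^ (K + 1)` as a formal power series. -/
noncomputable def seriesG {n : ℕ} (k : Fin n → ℕ) : PowerSeries ℚ :=
  (∑ i ∈ Finset.Icc 1 n,
      PowerSeries.C (eulerianNumber k i : ℚ) * (PowerSeries.X : PowerSeries ℚ) ^ i) *
    ((1 - (PowerSeries.X : PowerSeries ℚ)) ^ (multisetSize k + 1))⁻¹

/-- `g_k(x) = (∑_{i = K - n + 1}^{K} A_{k, K + 1 - i} x ^ i) / (1 - x) ^ (K + 1)` as a formal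
power series (all `k j` are meant to be positive, so that `n ≤ K`). -/
noncomputable def seriesg {n : ℕ} (k : Fin n → ℕ) : PowerSeries ℚ :=
  (∑ i ∈ Finset.Icc (multisetSize k - n + 1) (multisetSize k),
      PowerSeries.C (eulerianNumber k (multisetSize k + 1 - i) : ℚ) *
        (PowerSeries.X : PowerSeries ℚ) ^ i) *
    ((1 - (PowerSeries.X : PowerSeries ℚ)) ^ (multisetSize k + 1))⁻¹

/-- `B_k(m)`, the coefficient of `x ^ m` in `G_k(x)`. -/
noncomputable def stirlingB {n : ℕ} (k : Fin n → ℕ) (m : ℕ) : ℚ :=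
  PowerSeries.coeff m (seriesG k)

/-- `b_k(m)`, the coefficient of `x ^ m` in `g_k(x)`. -/
noncomputable def stirlingb {n : ℕ} (k : Fin n → ℕ) (m : ℕ) : ℚ :=
  PowerSeries.coeff m (seriesg k)

/-! ### Families of sets, partitions, left-to-right minima -/

/-- `F` is a partition of the set `s` (into nonempty, pairwise disjoint blocks). -/
def IsPartitionOf (F : Finset (Finset ℕ)) (s : Finset ℕ) : Prop :=
  ∃ P : Finpartition s, P.parts = F

/-- The set of the minimal elements of the members of `F`. -/
def familyMin (F : Finset (Finset ℕ)) : Set ℕ :=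
  {x | ∃ B ∈ F, IsLeast (B : Set ℕ) x}

/-- `a ∼_F b`: some member of `F` contains both `a` and `b`. -/
def SameBlock (F : Finset (Finset ℕ)) (a b : ℕ) : Prop :=
  ∃ B ∈ F, a ∈ B ∧ b ∈ B

/-- `F` is segmented with respect to the ground set `U`. -/
def IsSegmented (U : Finset ℕ) (F : Finset (Finset ℕ)) : Prop :=
  ∀ a ∈ U, ∀ b ∈ U, ∀ c ∈ U, a < b → b < c → SameBlock F a c → b ∈ familyMin F

/-- The set of left-to-right minima of a permutation of `{1, …, N}`. The permutation, in one-line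
notation, is `σ 0 + 1, …, σ (N - 1) + 1`. -/
def lmin {N : ℕ} (σ : Equiv.Perm (Fin N)) : Set ℕ :=
  {x | ∃ p : Fin N, (∀ q, q < p → σ p < σ q) ∧ x = (σ p : ℕ) + 1}

/-! ### The two counting numbers -/

/-- The number of pairs `(π₀, π₁)` such that `π₁` is a partition of `{1, …, N}` into `r` blocks,
`π₀` is a segmented (with respect to `{1, …, N + 1}`) partition of a subset of `{1, …, N + 1}`
into `r` blocks, both have the same block minima, and the least element of `{1, …, N}` that is
not a block minimum, if there is one, lies in the block of `1` in `π₀`. -/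
noncomputable def partitionPairs (N r : ℕ) : ℕ :=
  {p : Finset (Finset ℕ) × Finset (Finset ℕ) |
    IsPartitionOf p.2 (Finset.Icc 1 N) ∧ p.2.card = r ∧
    (∃ s ⊆ Finset.Icc 1 (N + 1), IsPartitionOf p.1 s) ∧ p.1.card = r ∧
    IsSegmented (Finset.Icc 1 (N + 1)) p.1 ∧
    familyMin p.2 = familyMin p.1 ∧
    ∀ x, IsLeast (Set.Icc 1 N \ familyMin p.2) x → SameBlock p.1 x 1}.ncard

/-- The number of pairs `(σ₀, σ₁)` such that `σ₁` is a permutation of `{1, …, N}` with `r`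
left-to-right minima, `σ₀` is a segmented partition of `{1, …, N + 1}` into `r` blocks, the block
minima of `σ₀` are the left-to-right minima of `σ₁`, and the least element of `{1, …, N}` that is
not a left-to-right minimum, if there is one, lies in the block of `1` in `σ₀`. The number is `0`
for negative `r`. -/
noncomputable def permutationPairs (N : ℕ) (r : ℤ) : ℕ :=
  {p : Finset (Finset ℕ) × Equiv.Perm (Fin N) |
    ((lmin p.2).ncard : ℤ) = r ∧
    IsPartitionOf p.1 (Finset.Icc 1 (N + 1)) ∧ (p.1.card : ℤ) = r ∧
    IsSegmented (Finset.Icc 1 (N + 1)) p.1 ∧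
    lmin p.2 = familyMin p.1 ∧
    ∀ x, IsLeast (Set.Icc 1 N \ lmin p.2) x → SameBlock p.1 x 1}.ncard

/-! Each identity holds because its two sides obey the same recursion in $n$.

Eulerian side: the three copies of the largest letter of a Stirling permutation are adjacent, since
nothing smaller may separate them. So every word on $n+1$ letters arises uniquely from one on $n$
letters by inserting a triple in one of $3n+1$ places. If the old word has $d$ descents, the $d$
places right after a descent (the end included) preserve $d$, and the others give $d+1$
(`sum_listDescents_insertTriple`). For the descent polynomial this reads
$A_{n+1}=x((1-x)A_n'+(3n+1)A_n)$, and division by the power of $1-x$ turns it into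
$(1-x)^2G_{n+1}=xG_n'$. The reversed numerators give the same equation with $x^3$ in place of $x$.
The coefficients are `stirlingBSeq` and `stirlingbSeq`.

Combinatorial side: fix the set $X\subseteq[N]$ of the $n$ elements that are not minima. All
remaining choices are independent over the elements. In $\pi_1$, an $x\in X$ joins the block of any
smaller minimum, which gives $x-1-|X_{<x}|$ choices. The permutations $\sigma_1$ give a factor $x-1$
(`card_perm_lmin`). In the segmented family, $N+1$ behaves like a further non-minimum. Being
segmented means that the block minimum of $x$ exceeds the preceding element $y$ of $X$, which leaves
$x-y-1$ choices, and one more if $x$ may stay uncovered. The condition on the least element of $X$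
forces its block minimum to be $1$ (`isSegmented_iff_blockMin_mem`). Deleting the largest element of
$X$, which then takes over the role of $N+1$, yields the same recursion (`gapWeight_insert`). -/

/-! ### Stirling words built by inserting triples -/

/-- The number of descents of a list, the last position being counted as a descent. -/
def listDescents : List ℕ → ℕ
  | [] => 0
  | [_] => 1
  | a :: b :: t => (if b < a then 1 else 0) + listDescents (b :: t)

/-- Insert three copies of `n` in front of the position `p`. -/
def insertTriple (n : ℕ) (l : List ℕ) (p : ℕ) : List ℕ :=
  l.take p ++ n :: n :: n :: l.drop p

/-- The Stirling permutations of `{0, 0, 0, …, n - 1, n - 1, n - 1}`. -/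
def stirlingWords : ℕ → Finset (List ℕ)
  | 0 => {[]}
  | n + 1 => (stirlingWords n ×ˢ Finset.range (3 * n + 1)).image
      fun q => insertTriple n q.1 q.2

/-- The front place is left out so that induction on the word can peel off its first letter. The
coefficients live in a ring, which avoids truncated subtraction. -/
theorem sum_listDescents_insertTriple_succ {R : Type*} [CommRing R] (n : ℕ) (l : List ℕ)
    (hl : ∀ a ∈ l, a < n) (f : ℕ → R) :
    ∑ p ∈ Finset.range l.length, f (listDescents (insertTriple n l (p + 1))) =
      (listDescents l : R) * f (listDescents l) +
        ((l.length : R) - listDescents l) * f (listDescents l + 1) := by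
  induction l generalizing f with
  | nil => simp [listDescents]
  | cons a t ih =>
    cases t with
    | nil =>
      have : ¬ n < a := by have := hl a (by simp); omega
      simp [listDescents, insertTriple, this]
    | cons b t =>
      have ha : a < n := hl a (by simp)
      have hb : b < n := hl b (by simp)
      -- The contribution of the first letter to the descents is constant here and is absorbed into
      -- `f`.
      have h1 := ih (fun c hc => hl c (by simp [hc]))
        (fun d => f ((if b < a then 1 else 0) + d))
      rw [List.length_cons, Finset.sum_range_succ']
      have h2 : ∀ p ∈ Finset.range (b :: t).length,
          f (listDescents (insertTriple n (a :: b :: t) (p + 1 + 1))) =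
          f ((if b < a then 1 else 0) + listDescents (insertTriple n (b :: t) (p + 1))) := by
        intro p _
        simp [insertTriple, listDescents]
      rw [Finset.sum_congr rfl h2, h1]
      -- Between `a` and `b` the triple creates the descent from `n` to `b` and destroys a possible
      -- descent from `a` to `b`.
      have h3 : listDescents (insertTriple n (a :: b :: t) (0 + 1)) =
          listDescents (b :: t) + 1 := by
        have : ¬ n < a := by omega
        simp [insertTriple, listDescents, this, hb]
        omega
      rw [h3]
      by_cases hba : b < a
      · simp only [listDescents, hba, if_true]
        rw [add_comm 1 (listDescents (b :: t)), add_comm 1 (listDescents (b :: t) + 1)]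
        push_cast
        ring
      · simp only [listDescents, hba, if_false, zero_add]
        push_cast
        ring

theorem sum_listDescents_insertTriple {R : Type*} [CommRing R] (n : ℕ) (l : List ℕ)
    (hl : ∀ a ∈ l, a < n) (f : ℕ → R) :
    ∑ p ∈ Finset.range (l.length + 1), f (listDescents (insertTriple n l p)) =
      (listDescents l : R) * f (listDescents l) +
        ((l.length : R) + 1 - listDescents l) * f (listDescents l + 1) := by
  rw [Finset.sum_range_succ', sum_listDescents_insertTriple_succ n l hl]
  have : listDescents (insertTriple n l 0) = listDescents l + 1 := by
    cases l with
    | nil => simp [insertTriple, listDescents]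
    | cons a t =>
      have : a < n := hl a (by simp)
      simp [insertTriple, listDescents, this]
      omega
  rw [this]
  ring

theorem listDescents_le_insertTriple (n : ℕ) (l : List ℕ) (hl : ∀ a ∈ l, a < n) (p : ℕ)
    (hp : p < l.length + 1) :
    listDescents (insertTriple n l p) ≤ listDescents l + 1 := by
  by_contra hcon
  -- With `f` the indicator of a forbidden number of descents the sum vanishes, hence so does each
  -- of its nonnegative terms.
  have h := sum_listDescents_insertTriple n l hl
    (fun d => if listDescents l + 1 < d then (1 : ℤ) else 0)
  simp only [lt_irrefl, if_false, mul_zero, add_zero,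
    if_neg (show ¬ listDescents l + 1 < listDescents l by omega)] at h
  have h2 := (Finset.sum_eq_zero_iff_of_nonneg (by intro i _; positivity)).1 h p
    (Finset.mem_range.2 hp)
  simp at h2
  omega

theorem listDescents_pos {l : List ℕ} (hl : l ≠ []) : 0 < listDescents l := by
  induction l with
  | nil => simp at hl
  | cons a t ih =>
    cases t with
    | nil => simp [listDescents]
    | cons b t => have := ih (by simp); simp only [listDescents]; omega

/-- The words with letters `0, …, n - 1`, three times each, in which no letter lies between two
copies of a larger letter. -/
def IsStirlingList (n : ℕ) (l : List ℕ) : Prop :=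
  (∀ a ∈ l, a < n) ∧ (∀ a < n, l.count a = 3) ∧ ∀ a b, List.Sublist [a, b, a] l → a ≤ b

theorem IsStirlingList.length {n : ℕ} {l : List ℕ} (h : IsStirlingList n l) :
    l.length = 3 * n := by
  have h1 := Multiset.sum_count_eq_card (s := Finset.range n) (m := (l : Multiset ℕ))
    (by intro a ha; simpa using h.1 a (by simpa using ha))
  simp only [Multiset.coe_count, Multiset.coe_card] at h1
  rw [← h1, Finset.sum_congr rfl (fun a ha => h.2.1 a (Finset.mem_range.1 ha))]
  simp [mul_comm]

theorem IsStirlingList.append_triple {n : ℕ} {u v : List ℕ} (h : IsStirlingList n (u ++ v)) :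
    IsStirlingList (n + 1) (u ++ n :: n :: n :: v) := by
  obtain ⟨h1, h2, h3⟩ := h
  have hu : n ∉ u := fun hn => lt_irrefl n (h1 n (by simp [hn]))
  have hv : n ∉ v := fun hn => lt_irrefl n (h1 n (by simp [hn]))
  refine ⟨?_, ?_, ?_⟩
  · intro a ha
    have : a ∈ u ++ v ∨ a = n := by simp at ha ⊢; tauto
    rcases this with h | h
    · have := h1 a h; omega
    · omega
  · intro a ha
    rcases Nat.lt_succ_iff_lt_or_eq.1 ha with h | h
    · have h4 := h2 a h
      have : n ≠ a := by omega
      simpa [List.count_cons, this] using h4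
    · subst h
      simp [List.count_eq_zero.2 hu, List.count_eq_zero.2 hv]
  · intro a b hab
    by_contra! hba
    have hmem : ∀ c ∈ u ++ n :: n :: n :: v, c ≤ n := by
      intro c hc
      have : c ∈ u ++ v ∨ c = n := by simp at hc ⊢; tauto
      rcases this with h | h
      · exact (h1 c h).le
      · omega
    have ha : a ≤ n := hmem a (hab.subset (by simp))
    rcases ha.lt_or_eq with ha | ha
    -- Discarding the letters `n` recovers `u ++ v`, where the condition is known.
    · have h4 := hab.filter (fun c => decide (c < n))
      have hu' : u.filter (fun c => decide (c < n)) = u :=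
        List.filter_eq_self.2 (by intro c hc; simpa using h1 c (by simp [hc]))
      have hv' : v.filter (fun c => decide (c < n)) = v :=
        List.filter_eq_self.2 (by intro c hc; simpa using h1 c (by simp [hc]))
      have hb : b < n := hba.trans ha
      simp [ha, hb, hu', hv'] at h4
      have := h3 a b h4
      omega
    · subst ha
      -- The pattern `n, b, n` must start at one of the inserted copies; dropping the other two
      -- would leave an `n` in `v`.
      have skip : ∀ t : List ℕ, List.Sublist [b, a] (a :: t) → List.Sublist [b, a] t := by
        intro t ht
        rcases List.sublist_cons_iff.1 ht with h | ⟨r, h, -⟩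
        · exact h
        · simp only [List.cons.injEq] at h
          omega
      have hv' : ¬ List.Sublist [b, a] v := fun h => hv (h.subset (by simp))
      obtain ⟨l1, l2, hl, hl1, hl2⟩ := List.sublist_append_iff.1 hab
      cases l1 with
      | cons c t =>
        simp only [List.cons_append, List.cons.injEq] at hl
        exact hu (hl1.subset (by simp [hl.1]))
      | nil =>
        simp only [List.nil_append] at hl
        rw [← hl] at hl2
        exact hv' (skip _ (skip _ (List.cons_sublist_cons.1 hl2)))

theorem IsStirlingList.exists_append {n : ℕ} {l : List ℕ} (h : IsStirlingList (n + 1) l) :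
    ∃ u v, l = u ++ n :: n :: n :: v ∧ IsStirlingList n (u ++ v) := by
  obtain ⟨h1, h2, h3⟩ := h
  have hc := h2 n (by omega)
  -- Consecutive copies of the largest letter are adjacent: a letter between them would be at least
  -- `n`, hence equal to `n`.
  have adj : ∀ x y z : List ℕ, l = x ++ n :: (y ++ n :: z) → n ∉ y → y = [] := by
    intro x y z hl hy
    rw [List.eq_nil_iff_forall_not_mem]
    intro b hb
    have hbn : b < n + 1 := h1 b (by simp [hl, hb])
    have : n ≤ b := by
      apply h3
      rw [hl]
      refine List.Sublist.trans ?_ (List.sublist_append_right _ _)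
      refine List.Sublist.cons_cons _ ?_
      exact List.Sublist.append (l₁ := [b]) (by simpa using hb) (r₁ := [n]) (by simp)
    have : b = n := by omega
    exact hy (this ▸ hb)
  obtain ⟨u, l1, hl1, hu⟩ := List.eq_append_cons_of_mem (List.count_pos_iff.1 (by rw [hc]; omega))
  rw [hl1] at hc
  simp [List.count_eq_zero.2 hu] at hc
  obtain ⟨x, l2, hl2, hx⟩ :=
    List.eq_append_cons_of_mem (List.count_pos_iff.1 (show 0 < l1.count n by rw [hc]; omega))
  have hx' := adj u x l2 (by rw [hl1, hl2]) hx
  subst hx'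
  simp only [List.nil_append] at hl2
  subst hl2
  simp at hc
  obtain ⟨y, v, hl3, hy⟩ :=
    List.eq_append_cons_of_mem (List.count_pos_iff.1 (show 0 < l2.count n by rw [hc]; omega))
  have hy' := adj (u ++ [n]) y v (by rw [hl1, hl3]; simp) hy
  subst hy'
  simp only [List.nil_append] at hl3
  subst hl3
  simp at hc
  refine ⟨u, v, hl1, ?_, ?_, ?_⟩
  · intro a ha
    have := h1 a (by rw [hl1]; simp at ha ⊢; tauto)
    have : a ≠ n := by
      rintro rfl
      simp [hu] at ha
      exact List.count_eq_zero.1 hc ha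
    omega
  · intro a ha
    have h4 := h2 a (by omega)
    have : n ≠ a := by omega
    rw [hl1] at h4
    simpa [List.count_cons, this] using h4
  · intro a b hab
    apply h3
    rw [hl1]
    exact hab.trans (List.Sublist.append (List.Sublist.refl _)
      (((List.sublist_cons_self _ _).trans (List.sublist_cons_self _ _)).trans
        (List.sublist_cons_self _ _)))

theorem mem_stirlingWords {n : ℕ} {l : List ℕ} : l ∈ stirlingWords n ↔ IsStirlingList n l := by
  induction n generalizing l with
  | zero =>
    simp only [stirlingWords, Finset.mem_singleton]
    constructor
    · rintro rfl; simp [IsStirlingList]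
    · intro h; simpa using h.length
  | succ n ih =>
    simp only [stirlingWords, Finset.mem_image, Finset.mem_product, Finset.mem_range, Prod.exists]
    constructor
    · rintro ⟨t, p, ⟨ht, -⟩, rfl⟩
      apply IsStirlingList.append_triple
      rw [List.take_append_drop]
      exact ih.1 ht
    · intro h
      obtain ⟨u, v, rfl, huv⟩ := h.exists_append
      refine ⟨u ++ v, u.length, ⟨ih.2 huv, ?_⟩, by simp [insertTriple]⟩
      have := huv.length
      simp at this
      omega

theorem insertTriple_injOn (n : ℕ) :
    Set.InjOn (fun q : List ℕ × ℕ => insertTriple n q.1 q.2)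
      (stirlingWords n ×ˢ Finset.range (3 * n + 1) : Finset (List ℕ × ℕ)) := by
  rintro ⟨l, p⟩ h ⟨l', p'⟩ h' heq
  simp only [Finset.coe_product, Set.mem_prod, Finset.mem_coe, Finset.mem_range,
    mem_stirlingWords] at h h'
  simp only [insertTriple] at heq
  have key : ∀ t : List ℕ, IsStirlingList n t → ∀ q, n ∉ t.take q := by
    intro t ht q hn
    exact lt_irrefl n (ht.1 n (List.mem_of_mem_take hn))
  have h1 := key l h.1 p
  have h2 := key l' h'.1 p'
  -- The place of insertion is read off as the position of the first `n`.
  have hi : ∀ u v : List ℕ, n ∉ u → (u ++ n :: v).idxOf n = u.length := by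
    intro u v hu
    rw [List.idxOf_append_of_notMem hu]; simp
  have hlen : (l.take p).length = (l'.take p').length := by
    rw [← hi _ _ h1, ← hi _ _ h2, heq]
  obtain ⟨e1, e2⟩ := List.append_inj heq hlen
  have e3 : l.drop p = l'.drop p' := by simpa using e2
  have e4 : l = l' := by
    rw [← List.take_append_drop p l, ← List.take_append_drop p' l', e1, e3]
  have := h.1.length
  have := h'.1.length
  simp only [List.length_take] at hlen
  ext1
  · exact e4
  · simp only; omega

theorem sum_stirlingWords_succ {R : Type*} [CommRing R] (n : ℕ) (f : ℕ → R) :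
    ∑ l ∈ stirlingWords (n + 1), f (listDescents l) =
      ∑ l ∈ stirlingWords n, ((listDescents l : R) * f (listDescents l) +
        (3 * n + 1 - listDescents l) * f (listDescents l + 1)) := by
  rw [stirlingWords, Finset.sum_image (insertTriple_injOn n), Finset.sum_product]
  refine Finset.sum_congr rfl fun l hl => ?_
  have hl := mem_stirlingWords.1 hl
  have h := sum_listDescents_insertTriple n l hl.1 f
  rw [hl.length] at h
  rw [h]
  push_cast
  rfl

theorem listDescents_le {n : ℕ} {l : List ℕ} (hl : l ∈ stirlingWords n) : listDescents l ≤ n := by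
  induction n generalizing l with
  | zero =>
    simp only [stirlingWords, Finset.mem_singleton] at hl
    simp [hl, listDescents]
  | succ n ih =>
    simp only [stirlingWords, Finset.mem_image, Finset.mem_product, Finset.mem_range,
      Prod.exists] at hl
    obtain ⟨t, p, ⟨ht, hp⟩, rfl⟩ := hl
    have h1 := mem_stirlingWords.1 ht
    have := listDescents_le_insertTriple n t h1.1 p (by rw [h1.length]; omega)
    have := ih ht
    omega

/-! ### From words as functions to lists -/

theorem ncard_isDescent {n K : ℕ} (w : Fin K → Fin n) :
    {p | IsDescent w p}.ncard = listDescents (List.ofFn fun p => (w p : ℕ)) := by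
  classical
  have h (K : ℕ) (w : Fin K → Fin n) :
      {p | IsDescent w p}.ncard = (Finset.univ.filter fun p => IsDescent w p).card := by
    rw [← Set.ncard_coe_finset]; simp
  induction K with
  | zero =>
    rw [h]
    simp [listDescents]
  | succ K ih =>
    have hs : ∀ p : Fin K, IsDescent w p.succ ↔ IsDescent (fun q => w q.succ) p := by
      intro p
      unfold IsDescent
      refine or_congr (by simp) ?_
      constructor
      · rintro ⟨q, hq, hw⟩
        have hq0 : q ≠ 0 := by
          rintro rfl; simp at hq
        obtain ⟨r, rfl⟩ := Fin.exists_succ_eq.2 hq0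
        exact ⟨r, by simpa using hq, hw⟩
      · rintro ⟨q, hq, hw⟩
        exact ⟨q.succ, by simpa using hq, hw⟩
    have ih' := ih (fun q => w q.succ)
    rw [h] at ih' ⊢
    rw [Fin.card_filter_univ_succ', List.ofFn_succ]
    simp only [hs]
    rw [ih']
    cases K with
    | zero =>
      have : IsDescent w 0 := Or.inl (by simp)
      simp [this, listDescents]
    | succ K =>
      rw [List.ofFn_succ, listDescents]
      have : IsDescent w 0 ↔ ((w (Fin.succ 0) : Fin n) : ℕ) < w 0 := by
        unfold IsDescent
        constructor
        · rintro (h | ⟨q, hq, hw⟩)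
          · simp at h
          · have : q = Fin.succ 0 := by
              ext; simpa using hq
            exact this ▸ hw
        · intro h
          exact Or.inr ⟨Fin.succ 0, by simp, h⟩
      simp only [this]

theorem sublist_ofFn_iff {K : ℕ} (v : Fin K → ℕ) (a b c : ℕ) :
    List.Sublist [a, b, c] (List.ofFn v) ↔
      ∃ p s q, p < s ∧ s < q ∧ v p = a ∧ v s = b ∧ v q = c := by
  constructor
  · intro h
    obtain ⟨f, hf⟩ := List.sublist_iff_exists_fin_orderEmbedding_get_eq.1 h
    have e : (List.ofFn v).length = K := List.length_ofFn
    refine ⟨Fin.cast e (f ⟨0, by simp⟩), Fin.cast e (f ⟨1, by simp⟩),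
      Fin.cast e (f ⟨2, by simp⟩), ?_, ?_, ?_, ?_, ?_⟩
    · have : f ⟨0, by simp⟩ < f ⟨1, by simp⟩ := f.lt_iff_lt.2 (by simp)
      simp only [Fin.lt_def, Fin.val_cast]; exact this
    · have : f ⟨1, by simp⟩ < f ⟨2, by simp⟩ := f.lt_iff_lt.2 (by simp)
      simp only [Fin.lt_def, Fin.val_cast]; exact this
    · have := hf ⟨0, by simp⟩; simp at this; exact this.symm
    · have := hf ⟨1, by simp⟩; simp at this; exact this.symm
    · have := hf ⟨2, by simp⟩; simp at this; exact this.symm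
  · rintro ⟨p, s, q, hps, hsq, rfl, rfl, rfl⟩
    have h : List.ofFn v = (List.finRange K).map v := List.ofFn_eq_map
    rw [h]
    have h2 : List.Sublist [p, s, q] (List.finRange K) := by
      apply List.sublist_of_subperm_of_pairwise (r := (· < ·))
      · apply List.Nodup.subperm
        · simp [hps.ne, hsq.ne, (hps.trans hsq).ne]
        · intro x _; simp
      · simp [hps, hsq, hps.trans hsq]
      · exact List.pairwise_lt_finRange K
    simpa using h2.map v

theorem count_ofFn {K : ℕ} (v : Fin K → ℕ) (a : ℕ) :
    (List.ofFn v).count a = (Finset.univ.filter fun p => v p = a).card := by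
  induction K with
  | zero => simp
  | succ K ih =>
    rw [List.ofFn_succ, List.count_cons, ih, Fin.card_filter_univ_succ', add_comm]
    simp

theorem isStirlingList_ofFn_iff {n K : ℕ} (w : Fin K → Fin n) :
    IsStirlingList n (List.ofFn fun p => (w p : ℕ)) ↔
      (∀ j : Fin n, (Finset.univ.filter fun p => w p = j).card = 3) ∧
        ∀ p s q, p < s → s < q → w p = w q → w p ≤ w s := by
  have hcount : ∀ j : Fin n, (List.ofFn fun p => (w p : ℕ)).count (j : ℕ) =
      (Finset.univ.filter fun p => w p = j).card := by
    intro j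
    rw [count_ofFn]
    simp [Fin.ext_iff]
  unfold IsStirlingList
  constructor
  · rintro ⟨-, h2, h3⟩
    refine ⟨fun j => by rw [← hcount]; exact h2 j j.2, ?_⟩
    intro p s q hps hsq hw
    exact h3 (w p) (w s) ((sublist_ofFn_iff _ _ _ _).2 ⟨p, s, q, hps, hsq, rfl, rfl, by rw [hw]⟩)
  · rintro ⟨h2, h3⟩
    refine ⟨?_, ?_, ?_⟩
    · intro a ha
      obtain ⟨p, rfl⟩ := List.mem_ofFn.1 ha
      exact (w p).2
    · intro a ha
      exact (hcount ⟨a, ha⟩).trans (h2 _)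
    · intro a b hab
      obtain ⟨p, s, q, hps, hsq, rfl, rfl, h⟩ := (sublist_ofFn_iff _ _ _ _).1 hab
      exact h3 p s q hps hsq (Fin.ext h.symm)

theorem multisetSize_three (n : ℕ) : multisetSize (fun _ : Fin n => 3) = 3 * n := by
  simp [multisetSize, mul_comm]

theorem eulerianNumber_three (n i : ℕ) :
    eulerianNumber (fun _ : Fin n => 3) i =
      ((stirlingWords n).filter fun l => listDescents l = i).card := by
  have hK := multisetSize_three n
  unfold eulerianNumber IsStirlingPerm
  -- The length occurs in the type of the words, so it is made a variable before being replaced by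
  -- `3 * n`.
  generalize multisetSize (fun _ : Fin n => 3) = K at hK
  subst hK
  rw [← Set.ncard_coe_finset]
  refine Set.ncard_congr (fun w _ => List.ofFn fun p => (w p : ℕ)) ?_ ?_ ?_
  · rintro w ⟨h1, h2⟩
    rw [ncard_isDescent] at h2
    exact Finset.mem_coe.2 (Finset.mem_filter.2
      ⟨mem_stirlingWords.2 ((isStirlingList_ofFn_iff w).2 h1), h2⟩)
  · intro w w' _ _ h
    have := List.ofFn_injective h
    funext p
    exact Fin.ext (congrFun this p)
  · intro l hl
    simp only [Finset.coe_filter, Set.mem_ofPred_eq, mem_stirlingWords] at hl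
    obtain ⟨hl, hd⟩ := hl
    have hlen := hl.length
    let w : Fin (3 * n) → Fin n := fun p =>
      ⟨l.get (Fin.cast hlen.symm p), hl.1 _ (List.get_mem _ _)⟩
    have hw : (List.ofFn fun p => (w p : ℕ)) = l := by
      apply List.ext_get
      · simp [hlen]
      · intro i h1 h2
        simp [w]
    refine ⟨w, ⟨?_, ?_⟩, hw⟩
    · rw [← isStirlingList_ofFn_iff, hw]; exact hl
    · rw [ncard_isDescent, hw]; exact hd

theorem sum_eulerianNumber {R : Type*} [CommRing R] (n : ℕ) (hn : 1 ≤ n) (f : ℕ → R) :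
    ∑ i ∈ Finset.Icc 1 n, (eulerianNumber (fun _ : Fin n => 3) i : R) * f i =
      ∑ l ∈ stirlingWords n, f (listDescents l) := by
  rw [← Finset.sum_fiberwise_of_maps_to (t := Finset.Icc 1 n) (g := listDescents)]
  · refine Finset.sum_congr rfl fun i _ => ?_
    rw [eulerianNumber_three, Finset.sum_congr rfl (g := fun _ => f i), Finset.sum_const,
      nsmul_eq_mul]
    intro l hl
    rw [(Finset.mem_filter.1 hl).2]
  · intro l hl
    refine Finset.mem_Icc.2 ⟨listDescents_pos ?_, listDescents_le hl⟩
    rintro rfl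
    have := (mem_stirlingWords.1 hl).length
    simp at this
    omega

/-! ### Recursions and generating functions -/

/-- The numbers `B_k(m)` for `k = (3, …, 3)`, by recursion. -/
def stirlingBSeq : ℕ → ℕ → ℕ
  | 0, _ => 1
  | n + 1, m => ∑ j ∈ Finset.range (m + 1), (m + 1 - j) * (j * stirlingBSeq n j)

/-- The numbers `b_k(m)` for `k = (3, …, 3)`, by recursion. -/
def stirlingbSeq : ℕ → ℕ → ℕ
  | 0, _ => 1
  | n + 1, m => ∑ j ∈ Finset.range m, (m - 1 - j) * (j * stirlingbSeq n j)

open PowerSeries in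
-- The sum is the convolution of `a` with the coefficients of $(1-X)^{-2}$.
theorem mk_sum_mul_eq {R : Type*} [CommRing R] (a : ℕ → R) :
    (mk fun m => ∑ j ∈ Finset.range (m + 1), ((m + 1 - j : ℕ) : R) * a j) * (1 - X) ^ 2 =
      mk a := by
  have h : (mk fun m => ∑ j ∈ Finset.range (m + 1), ((m + 1 - j : ℕ) : R) * a j) =
      mk a * (mk fun i => ((1 + i).choose 1 : R)) := by
    ext m
    rw [coeff_mul, coeff_mk, Finset.Nat.sum_antidiagonal_eq_sum_range_succ_mk]
    refine Finset.sum_congr rfl fun j hj => ?_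
    have : 1 + (m - j) = m + 1 - j := by have := Finset.mem_range.1 hj; omega
    simp only [coeff_mk, Nat.choose_one_right, this]
    ring
  have h2 := PowerSeries.mk_add_choose_mul_one_sub_pow_eq_one R 1
  simp only [pow_add, pow_one] at h2
  rw [h, mul_assoc, pow_two]
  rw [h2, mul_one]

open PowerSeries in
theorem stirlingBSeq_series (n : ℕ) :
    (mk fun m => (stirlingBSeq (n + 1) m : ℚ)) * (1 - X) ^ 2 =
      X * d⁄dX ℚ (mk fun m => (stirlingBSeq n m : ℚ)) := by
  have h := mk_sum_mul_eq (fun j => (j : ℚ) * stirlingBSeq n j)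
  simp only [stirlingBSeq]
  push_cast
  rw [h]
  ext m
  cases m with
  | zero => simp
  | succ m => rw [coeff_succ_X_mul, coeff_derivative]; simp; ring

open PowerSeries in
theorem stirlingbSeq_series (n : ℕ) :
    (mk fun m => (stirlingbSeq (n + 1) m : ℚ)) * (1 - X) ^ 2 =
      X ^ 3 * d⁄dX ℚ (mk fun m => (stirlingbSeq n m : ℚ)) := by
  have h := mk_sum_mul_eq (fun j => (j : ℚ) * stirlingbSeq n j)
  -- The weights `m - 1 - j` are those of the convolution two places earlier. The extra term `j = m
  -- - 1` has weight zero.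
  have h2 : (mk fun m => (stirlingbSeq (n + 1) m : ℚ)) = X ^ 2 * (mk fun m =>
      ∑ j ∈ Finset.range (m + 1), ((m + 1 - j : ℕ) : ℚ) * ((j : ℚ) * stirlingbSeq n j)) := by
    ext m
    rw [coeff_X_pow_mul', coeff_mk]
    rcases Nat.lt_or_ge m 2 with hm | hm
    · rw [if_neg (by omega)]
      interval_cases m <;> simp [stirlingbSeq]
    · obtain ⟨k, rfl⟩ := Nat.exists_eq_add_of_le hm
      rw [if_pos hm, coeff_mk, stirlingbSeq, show 2 + k - 2 = k by omega,
        show 2 + k = k + 1 + 1 by omega, Finset.sum_range_succ]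
      simp only [add_tsub_cancel_right, Nat.sub_self, zero_mul, add_zero]
      push_cast
      rfl
  rw [h2, mul_assoc, h]
  ext m
  rw [show (X : ℚ⟦X⟧) ^ 3 = X ^ 2 * X by ring, mul_assoc]
  congr 2
  ext m
  cases m with
  | zero => simp
  | succ m => rw [coeff_succ_X_mul, coeff_derivative]; simp; ring

open PowerSeries in
theorem one_sub_X_mul_mk_one : (mk fun _ => (1 : ℚ)) * (1 - X) = 1 :=
  PowerSeries.mk_one_mul_one_sub_eq_one ℚ

open PowerSeries in
theorem X_mul_derivative_X_pow (d : ℕ) :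
    X * d⁄dX ℚ ((X : ℚ⟦X⟧) ^ d) = (d : ℚ⟦X⟧) * X ^ d := by
  cases d with
  | zero => simp
  | succ d => rw [derivative_pow, derivative_X]; simp; ring

open PowerSeries in
-- The operator in the recursion for the descent polynomials becomes plain differentiation once the
-- power of $1-X$ is split off.
theorem derivative_mul_one_sub_pow (f : ℚ⟦X⟧) (k : ℕ) :
    (1 - X) * d⁄dX ℚ (f * (1 - X) ^ (k + 1)) + ((k : ℚ⟦X⟧) + 1) * (f * (1 - X) ^ (k + 1)) =
      d⁄dX ℚ f * (1 - X) ^ (k + 2) := by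
  rw [Derivation.leibniz, derivative_pow, map_sub, derivative_X]
  simp
  ring

open PowerSeries in
theorem sum_X_pow_listDescents (n : ℕ) :
    ∑ l ∈ stirlingWords n, (X : ℚ⟦X⟧) ^ listDescents l =
      (mk fun m => (stirlingBSeq n m : ℚ)) * (1 - X) ^ (3 * n + 1) := by
  induction n with
  | zero => simp [stirlingWords, listDescents, stirlingBSeq, one_sub_X_mul_mk_one]
  | succ n ih =>
    rw [sum_stirlingWords_succ n fun d => (X : ℚ⟦X⟧) ^ d]
    have h : ∑ l ∈ stirlingWords n, ((listDescents l : ℚ⟦X⟧) * X ^ listDescents l +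
        (3 * (n : ℚ⟦X⟧) + 1 - (listDescents l : ℚ⟦X⟧)) * X ^ (listDescents l + 1)) =
        X * ((1 - X) * d⁄dX ℚ (∑ l ∈ stirlingWords n, (X : ℚ⟦X⟧) ^ listDescents l) +
          (((3 * n : ℕ) : ℚ⟦X⟧) + 1) * ∑ l ∈ stirlingWords n, (X : ℚ⟦X⟧) ^ listDescents l) := by
      rw [map_sum, Finset.mul_sum, Finset.mul_sum, ← Finset.sum_add_distrib, Finset.mul_sum]
      refine Finset.sum_congr rfl fun l _ => ?_
      have := X_mul_derivative_X_pow (listDescents l)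
      push_cast
      linear_combination (-(1 - X)) * this
    rw [h, ih, derivative_mul_one_sub_pow]
    have := stirlingBSeq_series n
    rw [show 3 * (n + 1) + 1 = 2 + (3 * n + 2) by ring]
    linear_combination (-(1 - X) ^ (3 * n + 2)) * this

open PowerSeries in
theorem sum_X_pow_sub_listDescents (n : ℕ) (hn : 1 ≤ n) :
    ∑ l ∈ stirlingWords n, (X : ℚ⟦X⟧) ^ (3 * n + 1 - listDescents l) =
      (mk fun m => (stirlingbSeq n m : ℚ)) * (1 - X) ^ (3 * n + 1) := by
  -- The series is needed only up to a constant `c`, which differentiation kills. This covers the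
  -- start at `n = 0`.
  have step : ∀ (n : ℕ) (c : ℚ⟦X⟧), d⁄dX ℚ c = 0 →
      ∑ l ∈ stirlingWords n, (X : ℚ⟦X⟧) ^ (3 * n + 1 - listDescents l) =
        ((mk fun m => (stirlingbSeq n m : ℚ)) + c) * (1 - X) ^ (3 * n + 1) →
      ∑ l ∈ stirlingWords (n + 1), (X : ℚ⟦X⟧) ^ (3 * (n + 1) + 1 - listDescents l) =
        (mk fun m => (stirlingbSeq (n + 1) m : ℚ)) * (1 - X) ^ (3 * (n + 1) + 1) := by
    intro n c hc ih
    rw [sum_stirlingWords_succ n fun d => (X : ℚ⟦X⟧) ^ (3 * (n + 1) + 1 - d)]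
    have h : ∑ l ∈ stirlingWords n,
        ((listDescents l : ℚ⟦X⟧) * X ^ (3 * (n + 1) + 1 - listDescents l) +
        (3 * (n : ℚ⟦X⟧) + 1 - (listDescents l : ℚ⟦X⟧)) * X ^ (3 * (n + 1) + 1 - (listDescents l + 1))) =
        X ^ 3 * ((1 - X) * d⁄dX ℚ (∑ l ∈ stirlingWords n,
            (X : ℚ⟦X⟧) ^ (3 * n + 1 - listDescents l)) +
          (((3 * n : ℕ) : ℚ⟦X⟧) + 1) *
            ∑ l ∈ stirlingWords n, (X : ℚ⟦X⟧) ^ (3 * n + 1 - listDescents l)) := by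
      rw [map_sum, Finset.mul_sum, Finset.mul_sum, ← Finset.sum_add_distrib, Finset.mul_sum]
      refine Finset.sum_congr rfl fun l hl => ?_
      have hle := listDescents_le hl
      obtain ⟨e, he⟩ := Nat.exists_eq_add_of_le (show listDescents l ≤ 3 * n + 1 by omega)
      have := X_mul_derivative_X_pow e
      have he' := congrArg (Nat.cast (R := ℚ⟦X⟧)) he
      push_cast at he'
      rw [show 3 * n + 1 - listDescents l = e by omega,
        show 3 * (n + 1) + 1 - listDescents l = e + 3 by omega,
        show 3 * (n + 1) + 1 - (listDescents l + 1) = e + 2 by omega]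
      push_cast
      rw [he']
      linear_combination (-(1 - X)) * X ^ 2 * this
    rw [h, ih, derivative_mul_one_sub_pow, map_add, hc, add_zero]
    have := stirlingbSeq_series n
    rw [show 3 * (n + 1) + 1 = 2 + (3 * n + 2) by ring]
    linear_combination (-(1 - X) ^ (3 * n + 2)) * this
  induction n, hn using Nat.le_induction with
  | base =>
    -- For the empty word the left side is $X$, which is $(1/(1-X)-1)(1-X)$; hence the correction
    -- `-1`.
    refine step 0 (-1) (by simp) ?_
    simp only [stirlingWords, listDescents, stirlingbSeq, Finset.sum_singleton]
    have := one_sub_X_mul_mk_one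
    push_cast
    linear_combination -this
  | succ n _ ih => exact step n 0 (by simp) (by rw [ih, add_zero])

open PowerSeries in
theorem mul_one_sub_X_pow_inv (f : ℚ⟦X⟧) (k : ℕ) :
    f * (1 - X) ^ k * ((1 - X) ^ k)⁻¹ = f := by
  rw [mul_assoc, PowerSeries.mul_inv_cancel, mul_one]
  simp

open PowerSeries in
theorem stirlingB_three (n : ℕ) (hn : 1 ≤ n) (m : ℕ) :
    stirlingB (fun _ : Fin n => 3) m = stirlingBSeq n m := by
  have h := sum_eulerianNumber n hn fun i => (X : ℚ⟦X⟧) ^ i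
  unfold stirlingB seriesG
  simp only [map_natCast]
  rw [h, sum_X_pow_listDescents, multisetSize_three, mul_one_sub_X_pow_inv, coeff_mk]

open PowerSeries in
theorem stirlingb_three (n : ℕ) (hn : 1 ≤ n) (m : ℕ) :
    stirlingb (fun _ : Fin n => 3) m = stirlingbSeq n m := by
  have h := sum_eulerianNumber n hn fun i => (X : ℚ⟦X⟧) ^ (3 * n + 1 - i)
  unfold stirlingb seriesg
  simp only [map_natCast]
  rw [sum_X_pow_sub_listDescents n hn] at h
  rw [multisetSize_three]
  have h2 : ∑ i ∈ Finset.Icc (3 * n - n + 1) (3 * n),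
      (eulerianNumber (fun _ : Fin n => 3) (3 * n + 1 - i) : ℚ⟦X⟧) * X ^ i =
      ∑ i ∈ Finset.Icc 1 n,
        (eulerianNumber (fun _ : Fin n => 3) i : ℚ⟦X⟧) * X ^ (3 * n + 1 - i) := by
    refine Finset.sum_bij' (fun i _ => 3 * n + 1 - i) (fun i _ => 3 * n + 1 - i) ?_ ?_ ?_ ?_ ?_
    all_goals intro i hi; rw [Finset.mem_Icc] at hi
    · rw [Finset.mem_Icc]; omega
    · rw [Finset.mem_Icc]; omega
    · omega
    · omega
    · rw [show 3 * n + 1 - (3 * n + 1 - i) = i by omega]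
  rw [h2, h, mul_one_sub_X_pow_inv, coeff_mk]

/-! ### Disjoint families encoded by their block minima -/

/-- `F` consists of nonempty pairwise disjoint subsets of `U`. -/
def IsDisjointFamily (U : Finset ℕ) (F : Finset (Finset ℕ)) : Prop :=
  (∀ B ∈ F, B.Nonempty) ∧ (∀ B ∈ F, B ⊆ U) ∧
    ∀ B ∈ F, ∀ B' ∈ F, ∀ x, x ∈ B → x ∈ B' → B = B'

theorem isPartitionOf_iff {U : Finset ℕ} {F : Finset (Finset ℕ)} :
    IsPartitionOf F U ↔ IsDisjointFamily U F ∧ ∀ x ∈ U, ∃ B ∈ F, x ∈ B := by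
  constructor
  · rintro ⟨P, rfl⟩
    refine ⟨⟨fun B hB => P.nonempty_of_mem_parts hB, fun B hB => P.le hB, ?_⟩,
      fun x hx => P.exists_mem hx⟩
    intro B hB B' hB' x hx hx'
    exact P.eq_of_mem_parts hB hB' hx hx'
  · rintro ⟨⟨h1, h2, h3⟩, h4⟩
    refine ⟨Finpartition.ofExistsUnique F h2 ?_ ?_, rfl⟩
    · intro a ha
      obtain ⟨B, hB, haB⟩ := h4 a ha
      exact ⟨B, ⟨hB, haB⟩, fun B' h => h3 _ h.1 _ hB a h.2 haB⟩
    · intro h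
      simpa using h1 _ h

theorem exists_isPartitionOf_iff {U : Finset ℕ} {F : Finset (Finset ℕ)} :
    (∃ s ⊆ U, IsPartitionOf F s) ↔ IsDisjointFamily U F := by
  constructor
  · rintro ⟨s, hs, h⟩
    obtain ⟨⟨h1, h2, h3⟩, -⟩ := isPartitionOf_iff.1 h
    exact ⟨h1, fun B hB => (h2 B hB).trans hs, h3⟩
  · rintro ⟨h1, h2, h3⟩
    refine ⟨F.sup id, Finset.sup_le h2, isPartitionOf_iff.2 ⟨⟨h1, ?_, h3⟩, ?_⟩⟩
    · intro B hB
      exact Finset.le_sup (f := id) hB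
    · intro x hx
      simpa [Finset.mem_sup] using hx

/-- The least element of the block of `x`, or `0` if no block contains `x`. -/
noncomputable def blockMin (F : Finset (Finset ℕ)) (x : ℕ) : ℕ :=
  sInf {a | SameBlock F a x}

theorem blockMin_eq_zero {F : Finset (Finset ℕ)} {x : ℕ} (h : ∀ B ∈ F, x ∉ B) :
    blockMin F x = 0 := by
  unfold blockMin
  convert Nat.sInf_empty
  ext a
  simp only [Set.mem_ofPred_eq, Set.mem_empty_iff_false, iff_false]
  rintro ⟨B, hB, -, hx⟩
  exact h B hB hx

theorem IsDisjointFamily.isLeast_blockMin {U : Finset ℕ} {F : Finset (Finset ℕ)}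
    (hF : IsDisjointFamily U F) {B : Finset ℕ} (hB : B ∈ F) {x : ℕ} (hx : x ∈ B) :
    IsLeast (B : Set ℕ) (blockMin F x) := by
  have h : {a | SameBlock F a x} = B := by
    ext a
    constructor
    · rintro ⟨B', hB', ha, hx'⟩
      rwa [hF.2.2 B hB B' hB' x hx hx']
    · intro ha
      exact ⟨B, hB, ha, hx⟩
  unfold blockMin
  rw [h]
  exact ⟨Nat.sInf_mem ⟨x, hx⟩, fun a ha => Nat.sInf_le ha⟩

theorem IsDisjointFamily.blockMin_ne_zero {U : Finset ℕ} {F : Finset (Finset ℕ)}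
    (hF : IsDisjointFamily U F) (hU : 0 ∉ U) {B : Finset ℕ} (hB : B ∈ F) {x : ℕ} (hx : x ∈ B) :
    blockMin F x ≠ 0 := by
  intro h
  have := (hF.isLeast_blockMin hB hx).1
  rw [h] at this
  exact hU (hF.2.1 B hB this)

theorem IsDisjointFamily.blockMin_eq_zero_iff {U : Finset ℕ} {F : Finset (Finset ℕ)}
    (hF : IsDisjointFamily U F) (hU : 0 ∉ U) {x : ℕ} :
    blockMin F x = 0 ↔ ∀ B ∈ F, x ∉ B :=
  ⟨fun h _ hB hx => hF.blockMin_ne_zero hU hB hx h, blockMin_eq_zero⟩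

/-- The block with least element `a` and further elements `x ∈ Y` with `f x = a`. -/
def fiberBlock (Y : Finset ℕ) (f : ℕ → ℕ) (a : ℕ) : Finset ℕ :=
  insert a (Y.filter fun x => f x = a)

/-- The family of blocks with the set `M` of least elements, given by `f` on the set `Y` of the
remaining elements. -/
def fiberFamily (M Y : Finset ℕ) (f : ℕ → ℕ) : Finset (Finset ℕ) :=
  M.image (fiberBlock Y f)

section fiberFamily

variable {U M : Finset ℕ} {f : ℕ → ℕ}

theorem mem_fiberBlock {Y : Finset ℕ} {a x : ℕ} :
    x ∈ fiberBlock Y f a ↔ x = a ∨ x ∈ Y ∧ f x = a := by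
  simp [fiberBlock]

theorem isLeast_fiberBlock {a : ℕ} (hM : 0 ∉ M) (ha : a ∈ M)
    (hf : ∀ x ∈ U \ M, f x ∈ insert 0 (M.filter (· < x))) :
    IsLeast (fiberBlock (U \ M) f a : Set ℕ) a := by
  refine ⟨by simp [fiberBlock], ?_⟩
  intro x hx
  rcases mem_fiberBlock.1 (Finset.mem_coe.1 hx) with rfl | ⟨hxY, rfl⟩
  · exact le_rfl
  · have := hf x hxY
    simp only [Finset.mem_insert, Finset.mem_filter] at this
    rcases this with h | h
    · exact absurd (h ▸ ha) hM
    · exact h.2.le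

theorem fiberBlock_eq_of_mem {a b x : ℕ} (ha : a ∈ M) (hb : b ∈ M)
    (hxa : x ∈ fiberBlock (U \ M) f a) (hxb : x ∈ fiberBlock (U \ M) f b) : a = b := by
  rw [mem_fiberBlock, Finset.mem_sdiff] at hxa hxb
  rcases hxa with rfl | ⟨h, rfl⟩ <;> rcases hxb with rfl | ⟨h', rfl⟩ <;> first | rfl | tauto

theorem isDisjointFamily_fiberFamily (hMU : M ⊆ U) :
    IsDisjointFamily U (fiberFamily M (U \ M) f) := by
  refine ⟨?_, ?_, ?_⟩
  · intro B hB
    obtain ⟨a, ha, rfl⟩ := Finset.mem_image.1 hB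
    exact ⟨a, by simp [fiberBlock]⟩
  · intro B hB
    obtain ⟨a, ha, rfl⟩ := Finset.mem_image.1 hB
    intro x hx
    rcases mem_fiberBlock.1 hx with rfl | ⟨hx, -⟩
    · exact hMU ha
    · exact (Finset.mem_sdiff.1 hx).1
  · intro B hB B' hB' x hx hx'
    obtain ⟨a, ha, rfl⟩ := Finset.mem_image.1 hB
    obtain ⟨b, hb, rfl⟩ := Finset.mem_image.1 hB'
    rw [fiberBlock_eq_of_mem ha hb hx hx']

theorem familyMin_fiberFamily (hM : 0 ∉ M)
    (hf : ∀ x ∈ U \ M, f x ∈ insert 0 (M.filter (· < x))) :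
    familyMin (fiberFamily M (U \ M) f) = M := by
  ext a
  constructor
  · rintro ⟨B, hB, h⟩
    obtain ⟨b, hb, rfl⟩ := Finset.mem_image.1 hB
    rw [h.unique (isLeast_fiberBlock hM hb hf)]
    exact hb
  · intro ha
    exact ⟨_, Finset.mem_image_of_mem _ ha, isLeast_fiberBlock hM ha hf⟩

theorem blockMin_fiberFamily (hMU : M ⊆ U) (hM : 0 ∉ M)
    (hf : ∀ x ∈ U \ M, f x ∈ insert 0 (M.filter (· < x))) {x : ℕ} (hx : x ∈ U \ M) :
    blockMin (fiberFamily M (U \ M) f) x = f x := by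
  by_cases h0 : f x = 0
  · rw [h0]
    apply blockMin_eq_zero
    intro B hB hxB
    obtain ⟨b, hb, rfl⟩ := Finset.mem_image.1 hB
    rcases mem_fiberBlock.1 hxB with rfl | ⟨-, rfl⟩
    · exact (Finset.mem_sdiff.1 hx).2 hb
    · exact hM (h0 ▸ hb)
  · have h1 : f x ∈ M := by
      have := hf x hx
      simp only [Finset.mem_insert, Finset.mem_filter] at this
      tauto
    exact ((isDisjointFamily_fiberFamily hMU).isLeast_blockMin (Finset.mem_image_of_mem _ h1)
      (mem_fiberBlock.2 (Or.inr ⟨hx, rfl⟩))).unique (isLeast_fiberBlock hM h1 hf)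

end fiberFamily

theorem IsDisjointFamily.blockMin_mem {U M : Finset ℕ} {F : Finset (Finset ℕ)}
    (hF : IsDisjointFamily U F) (hM : familyMin F = M) {x : ℕ} (hx : x ∈ U \ M) :
    blockMin F x ∈ insert 0 (M.filter (· < x)) := by
  by_cases h : ∃ B ∈ F, x ∈ B
  · obtain ⟨B, hB, hxB⟩ := h
    have h1 := hF.isLeast_blockMin hB hxB
    have h2 : blockMin F x ∈ M := by
      rw [← Finset.mem_coe, ← hM]
      exact ⟨B, hB, h1⟩
    refine Finset.mem_insert_of_mem (Finset.mem_filter.2 ⟨h2, ?_⟩)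
    refine lt_of_le_of_ne (h1.2 hxB) ?_
    intro he
    exact (Finset.mem_sdiff.1 hx).2 (he ▸ h2)
  · push Not at h
    rw [blockMin_eq_zero h]
    exact Finset.mem_insert_self _ _

/-- A block is its minimum together with the non-minima mapped to it. As `0` is outside `U`, the
value `0` can mark uncovered elements. -/
theorem IsDisjointFamily.eq_fiberFamily {U M : Finset ℕ} {F : Finset (Finset ℕ)}
    (hF : IsDisjointFamily U F) (hU : 0 ∉ U) (hM : familyMin F = M) :
    F = fiberFamily M (U \ M) (blockMin F) := by
  have key : ∀ B ∈ F, ∀ a, IsLeast (B : Set ℕ) a → fiberBlock (U \ M) (blockMin F) a = B := by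
    intro B hB a ha
    ext x
    rw [mem_fiberBlock]
    constructor
    · rintro (rfl | ⟨hx, rfl⟩)
      · exact ha.1
      · by_cases h : ∃ B ∈ F, x ∈ B
        · obtain ⟨B', hB', hxB⟩ := h
          have h1 := hF.isLeast_blockMin hB' hxB
          rwa [hF.2.2 B hB B' hB' _ ha.1 h1.1]
        · push Not at h
          exact absurd (hF.2.1 B hB (Finset.mem_coe.1 ha.1)) (by rwa [blockMin_eq_zero h])
    · intro hx
      have h1 := hF.isLeast_blockMin hB hx
      by_cases hxM : x ∈ M
      · left
        rw [← Finset.mem_coe, ← hM] at hxM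
        obtain ⟨B', hB', h2⟩ := hxM
        rw [← hF.2.2 B hB B' hB' x hx h2.1] at h2
        exact h2.unique ha
      · right
        exact ⟨Finset.mem_sdiff.2 ⟨hF.2.1 B hB hx, hxM⟩, h1.unique ha⟩
  ext B
  simp only [fiberFamily, Finset.mem_image]
  constructor
  · intro hB
    obtain ⟨x, hx⟩ := hF.1 B hB
    have h1 := hF.isLeast_blockMin hB hx
    refine ⟨_, ?_, key B hB _ h1⟩
    rw [← Finset.mem_coe, ← hM]
    exact ⟨B, hB, h1⟩
  · rintro ⟨a, ha, rfl⟩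
    rw [← Finset.mem_coe, ← hM] at ha
    obtain ⟨B, hB, h⟩ := ha
    rwa [key B hB a h]

theorem IsDisjointFamily.card_eq {U M : Finset ℕ} {F : Finset (Finset ℕ)}
    (hF : IsDisjointFamily U F) (hU : 0 ∉ U) (hM : familyMin F = M) : F.card = M.card := by
  rw [hF.eq_fiberFamily hU hM, fiberFamily, Finset.card_image_of_injOn]
  intro a ha b hb hab
  refine fiberBlock_eq_of_mem ha hb (x := a) (f := blockMin F) (U := U) ?_ ?_
  · simp [fiberBlock]
  · rw [← hab]; simp [fiberBlock]

theorem IsDisjointFamily.familyMin_subset {U : Finset ℕ} {F : Finset (Finset ℕ)}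
    (hF : IsDisjointFamily U F) : familyMin F ⊆ U := by
  rintro x ⟨B, hB, hx⟩
  exact hF.2.1 B hB hx.1

/-- The families of disjoint subsets of `U` with set of block minima `M`, such that for `x ∉ M` the
minimum of the block of `x` lies in `C x`. -/
def familiesWith (U M : Finset ℕ) (C : ℕ → Finset ℕ) : Finset (Finset (Finset ℕ)) :=
  ((U \ M).pi C).image fun g =>
    fiberFamily M (U \ M) fun x => if h : x ∈ U \ M then g x h else 0

section familiesWith

variable {U M : Finset ℕ} {C : ℕ → Finset ℕ}

theorem mem_familiesWith (hMU : M ⊆ U) (hU : 0 ∉ U)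
    (hC : ∀ x ∈ U \ M, C x ⊆ insert 0 (M.filter (· < x))) {F : Finset (Finset ℕ)} :
    F ∈ familiesWith U M C ↔
      IsDisjointFamily U F ∧ familyMin F = M ∧ ∀ x ∈ U \ M, blockMin F x ∈ C x := by
  have hM : 0 ∉ M := fun h => hU (hMU h)
  constructor
  · intro h
    obtain ⟨g, hg, rfl⟩ := Finset.mem_image.1 h
    rw [Finset.mem_pi] at hg
    have hf : ∀ x ∈ U \ M, (fun x => if h : x ∈ U \ M then g x h else 0) x ∈
        insert 0 (M.filter (· < x)) := by
      intro x hx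
      simp only [dif_pos hx]
      exact hC x hx (hg x hx)
    refine ⟨isDisjointFamily_fiberFamily hMU, familyMin_fiberFamily hM hf, ?_⟩
    intro x hx
    rw [blockMin_fiberFamily hMU hM hf hx]
    simp only [dif_pos hx]
    exact hg x hx
  · rintro ⟨h1, h2, h3⟩
    refine Finset.mem_image.2 ⟨fun x _ => blockMin F x, Finset.mem_pi.2 h3, ?_⟩
    conv_rhs => rw [h1.eq_fiberFamily hU h2]
    unfold fiberFamily fiberBlock
    refine Finset.image_congr fun a _ => ?_
    simp only
    congr 1
    refine Finset.filter_congr fun x hx => ?_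
    rw [dif_pos hx]

/-- The map `blockMin` recovers the choice function, so the choices for different `x` are
independent. -/
theorem card_familiesWith (hMU : M ⊆ U) (hU : 0 ∉ U)
    (hC : ∀ x ∈ U \ M, C x ⊆ insert 0 (M.filter (· < x))) :
    (familiesWith U M C).card = ∏ x ∈ U \ M, (C x).card := by
  have hM : 0 ∉ M := fun h => hU (hMU h)
  rw [familiesWith, Finset.card_image_of_injOn, Finset.card_pi]
  intro g hg g' hg' heq
  have hf : ∀ g ∈ (U \ M).pi C, ∀ x ∈ U \ M, (fun x => if h : x ∈ U \ M then g x h else 0) x ∈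
      insert 0 (M.filter (· < x)) := by
    intro g hg x hx
    simp only [dif_pos hx]
    exact hC x hx (Finset.mem_pi.1 hg x hx)
  funext x hx
  have h1 := blockMin_fiberFamily hMU hM (hf g hg) hx
  have h2 := blockMin_fiberFamily hMU hM (hf g' hg') hx
  simp only [dif_pos hx] at h1 h2
  rw [← h1, ← h2]
  exact congrArg (fun F => blockMin F x) heq

end familiesWith

/-! ### Permutations with a given set of left-to-right minima -/

/-- A value is a left-to-right minimum exactly when it precedes all smaller values. This turns
minima recorded by value into minima of the inverse recorded by position. -/
theorem mem_lmin_iff {N : ℕ} (σ : Equiv.Perm (Fin N)) (v : Fin N) :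
    (v : ℕ) + 1 ∈ lmin σ ↔ ∀ u < v, σ.symm v < σ.symm u := by
  constructor
  · rintro ⟨p, hp, h⟩ u hu
    have hv : v = σ p := Fin.ext (by omega)
    subst hv
    rw [Equiv.symm_apply_apply]
    by_contra! hle
    rcases hle.lt_or_eq with h1 | h1
    · have := hp _ h1
      rw [Equiv.apply_symm_apply] at this
      exact lt_asymm this hu
    · rw [← h1, Equiv.apply_symm_apply] at hu
      exact lt_irrefl _ hu
  · intro h
    refine ⟨σ.symm v, ?_, by simp⟩
    intro q hq
    rw [Equiv.apply_symm_apply]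
    by_contra! hle
    rcases hle.lt_or_eq with h1 | h1
    · have := h _ h1
      rw [Equiv.symm_apply_apply] at this
      exact lt_asymm this hq
    · rw [← h1, Equiv.symm_apply_apply] at hq
      exact lt_irrefl _ hq

theorem lmin_subset {N : ℕ} (σ : Equiv.Perm (Fin N)) : lmin σ ⊆ Set.Icc 1 N := by
  rintro x ⟨p, -, rfl⟩
  exact ⟨by omega, (σ p).2⟩

/-- The permutation with last value `p` and the remaining values in the relative order of `τ`. -/
def snocPerm {N : ℕ} (q : Fin (N + 1) × Equiv.Perm (Fin N)) : Equiv.Perm (Fin (N + 1)) :=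
  (finSuccEquiv' (Fin.last N)).trans
    ((Equiv.optionCongr q.2).trans (finSuccEquiv' q.1).symm)

theorem snocPerm_last {N : ℕ} (q : Fin (N + 1) × Equiv.Perm (Fin N)) :
    snocPerm q (Fin.last N) = q.1 := by
  simp [snocPerm]

theorem snocPerm_castSucc {N : ℕ} (q : Fin (N + 1) × Equiv.Perm (Fin N)) (v : Fin N) :
    snocPerm q v.castSucc = q.1.succAbove (q.2 v) := by
  simp [snocPerm, finSuccEquiv'_last_apply_castSucc]

theorem snocPerm_bijective (N : ℕ) : Function.Bijective (snocPerm (N := N)) := by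
  rw [Fintype.bijective_iff_injective_and_card]
  constructor
  · rintro ⟨p, τ⟩ ⟨p', τ'⟩ h
    have h1 : p = p' := by
      have h2 := congrArg (fun e => e (Fin.last N)) h
      simpa only [snocPerm_last] using h2
    subst h1
    refine Prod.ext rfl (Equiv.ext fun v => ?_)
    have h2 := congrArg (fun e => e v.castSucc) h
    simp only [snocPerm_castSucc] at h2
    exact Fin.succAbove_right_injective h2
  · simp [Fintype.card_perm, Nat.factorial_succ]

/-- The last position fails to be a left-to-right minimum unless its value is the least one, so it
contributes `N` choices or one. The relative order of the earlier values is independent of that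
choice. -/
theorem card_perm_filter (N : ℕ) (X : Finset ℕ) :
    Fintype.card {τ : Equiv.Perm (Fin N) //
      ∀ v : Fin N, (v : ℕ) + 1 ∈ X ↔ ∃ u < v, τ u < τ v} =
      ∏ v ∈ Finset.range N, if v + 1 ∈ X then v else 1 := by
  classical
  induction N with
  | zero => simp
  | succ N ih =>
    have key : ∀ q : Fin (N + 1) × Equiv.Perm (Fin N),
        (∀ v : Fin (N + 1), (v : ℕ) + 1 ∈ X ↔ ∃ u < v, snocPerm q u < snocPerm q v) ↔
        (N + 1 ∈ X ↔ q.1 ≠ 0) ∧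
          ∀ v : Fin N, (v : ℕ) + 1 ∈ X ↔ ∃ u < v, q.2 u < q.2 v := by
      intro q
      rw [Fin.forall_fin_succ', and_comm]
      refine and_congr ?_ (forall_congr' fun v => ?_)
      · rw [Fin.val_last, snocPerm_last]
        refine iff_congr Iff.rfl ?_
        constructor
        · rintro ⟨u, -, h⟩ h0
          rw [h0] at h
          exact absurd h (Fin.not_lt_zero _)
        · intro h
          -- The position of the least value is the witness; it is not the last one.
          refine ⟨(snocPerm q).symm 0, ?_, ?_⟩
          · rw [Fin.lt_last_iff_ne_last]
            intro h1
            rw [Equiv.symm_apply_eq, snocPerm_last] at h1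
            exact h h1.symm
          · rw [Equiv.apply_symm_apply]
            exact Fin.pos_iff_ne_zero.2 h
      · refine iff_congr Iff.rfl ?_
        constructor
        · rintro ⟨u, hu, h⟩
          have hul : u ≠ Fin.last N := (lt_of_lt_of_le hu (Fin.le_last _)).ne
          obtain ⟨w, rfl⟩ := Fin.exists_castSucc_eq.2 hul
          rw [snocPerm_castSucc, snocPerm_castSucc, Fin.succAbove_lt_succAbove_iff] at h
          exact ⟨w, by simpa using hu, h⟩
        · rintro ⟨u, hu, h⟩
          refine ⟨u.castSucc, by simpa using hu, ?_⟩
          rw [snocPerm_castSucc, snocPerm_castSucc, Fin.succAbove_lt_succAbove_iff]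
          exact h
    have e1 := Fintype.card_congr
      ((Equiv.ofBijective _ (snocPerm_bijective N)).subtypeEquiv
        (p := fun q => (N + 1 ∈ X ↔ q.1 ≠ 0) ∧
          ∀ v : Fin N, (v : ℕ) + 1 ∈ X ↔ ∃ u < v, q.2 u < q.2 v)
        (q := fun τ => ∀ v : Fin (N + 1), (v : ℕ) + 1 ∈ X ↔ ∃ u < v, τ u < τ v)
        (fun q => (key q).symm))
    rw [← e1, Fintype.card_congr (Equiv.subtypeProdEquivProd
        (p := fun p : Fin (N + 1) => N + 1 ∈ X ↔ p ≠ 0)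
        (q := fun τ : Equiv.Perm (Fin N) => ∀ v : Fin N, (v : ℕ) + 1 ∈ X ↔ ∃ u < v, τ u < τ v)),
      Fintype.card_prod, ih, Finset.prod_range_succ, mul_comm]
    congr 1
    by_cases h : N + 1 ∈ X
    · simp [h, Fintype.card_subtype_compl]
    · simp [h]

theorem card_perm_lmin {N : ℕ} {X : Finset ℕ} (hX : X ⊆ Finset.Icc 1 N) :
    {σ : Equiv.Perm (Fin N) | lmin σ = ((Finset.Icc 1 N \ X : Finset ℕ) : Set ℕ)}.ncard =
      ∏ x ∈ X, (x - 1) := by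
  classical
  have h1 : ∏ x ∈ X, (x - 1) = ∏ v ∈ Finset.range N, if v + 1 ∈ X then v else 1 := by
    rw [← Finset.prod_filter]
    refine Finset.prod_bij' (fun x _ => x - 1) (fun v _ => v + 1) ?_ ?_ ?_ ?_ ?_
    · intro x hx
      have := Finset.mem_Icc.1 (hX hx)
      rw [Finset.mem_filter, Finset.mem_range, Nat.sub_add_cancel this.1]
      exact ⟨by omega, hx⟩
    · intro v hv
      exact (Finset.mem_filter.1 hv).2
    · intro x hx
      have := Finset.mem_Icc.1 (hX hx)
      omega
    · intro v _
      omega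
    · intro x _
      rfl
  rw [h1, ← card_perm_filter, ← Nat.card_eq_fintype_card, ← Nat.card_coe_set_eq]
  refine Nat.card_congr ((Equiv.inv _).subtypeEquiv fun σ => ?_)
  have h2 : (∀ v : Fin N, (v : ℕ) + 1 ∈ X ↔ ∃ u < v, (σ⁻¹) u < (σ⁻¹) v) ↔
      ∀ v : Fin N, (v : ℕ) + 1 ∈ lmin σ ↔ (v : ℕ) + 1 ∉ X := by
    refine forall_congr' fun v => ?_
    rw [mem_lmin_iff, ← not_iff_not (a := _ ∈ X), iff_comm (a := _ ∉ X)]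
    refine iff_congr ?_ Iff.rfl
    push Not
    refine forall₂_congr fun u hu => ?_
    constructor
    · intro h
      exact lt_of_le_of_ne h (fun he => hu.ne' ((σ⁻¹).injective he))
    · exact fun h => h.le
  refine Iff.trans ?_ h2.symm
  simp only [Set.mem_ofPred_eq]
  constructor
  · intro h v
    rw [h]
    simp
  · intro h
    ext x
    constructor
    · intro hx
      have hx' := lmin_subset σ hx
      have := h ⟨x - 1, by have := hx'.1; have := hx'.2; omega⟩
      simp only [Nat.sub_add_cancel hx'.1] at this
      simp only [Finset.coe_sdiff, Finset.coe_Icc]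
      exact ⟨hx', this.1 hx⟩
    · intro hx
      simp only [Finset.coe_sdiff, Finset.coe_Icc] at hx
      have := h ⟨x - 1, by have := hx.1.1; have := hx.1.2; omega⟩
      simp only [Nat.sub_add_cancel hx.1.1] at this
      exact this.2 hx.2

/-! ### Weighted sums over the sets of elements that are not block minima -/

/-- Splits the sets by their largest element `j + 1`. -/
theorem sum_powersetCard_succ_Icc {R : Type*} [AddCommMonoid R] (n N : ℕ) (f : Finset ℕ → R) :
    ∑ X ∈ (Finset.Icc 1 N).powersetCard (n + 1), f X =
      ∑ j ∈ Finset.range N, ∑ X ∈ (Finset.Icc 1 j).powersetCard n, f (insert (j + 1) X) := by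
  induction N with
  | zero =>
    rw [Finset.powersetCard_eq_empty.2 (by simp)]
    simp
  | succ N ih =>
    have hN : N + 1 ∉ Finset.Icc 1 N := by simp
    rw [Finset.sum_range_succ, ← ih, ← Finset.insert_Icc_right_eq_Icc_add_one (by omega),
      Finset.powersetCard_succ_insert hN, Finset.sum_union, Finset.sum_image]
    · intro X hX Y hY hXY
      have hX := (Finset.mem_powersetCard.1 (Finset.mem_coe.1 hX)).1
      have hY := (Finset.mem_powersetCard.1 (Finset.mem_coe.1 hY)).1
      rw [← Finset.erase_insert (fun h => hN (hX h)), ← Finset.erase_insert (fun h => hN (hY h))]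
      exact congrArg (fun Z => Finset.erase Z (N + 1)) hXY
    · rw [Finset.disjoint_left]
      intro X hX hX'
      obtain ⟨Y, -, rfl⟩ := Finset.mem_image.1 hX'
      exact hN ((Finset.mem_powersetCard.1 hX).1 (Finset.mem_insert_self _ _))

/-- The product of the factors `α` over `X` and of the factors `β` over `X ∪ {N + 1}`, where the
factor at `x` depends on the elements of `X` below `x`. -/
def gapWeight (α β : Finset ℕ → ℕ → ℕ) (N : ℕ) (X : Finset ℕ) : ℕ :=
  (∏ x ∈ X, α (X.filter (· < x)) x) * ∏ x ∈ insert (N + 1) X, β (X.filter (· < x)) x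

/-- The factors at other elements of `X` do not see the largest element `j + 1`. Its own factor `β`
is the boundary factor of the weight at level `j`. -/
theorem gapWeight_insert (α β : Finset ℕ → ℕ → ℕ) {N j : ℕ} (hj : j < N) {X : Finset ℕ}
    (hX : X ⊆ Finset.Icc 1 j) :
    gapWeight α β N (insert (j + 1) X) =
      α X (j + 1) * β (insert (j + 1) X) (N + 1) * gapWeight α β j X := by
  have hlt : ∀ x ∈ X, x < j + 1 := fun x hx => by have := Finset.mem_Icc.1 (hX hx); omega
  have hjX : j + 1 ∉ X := fun h => lt_irrefl _ (hlt _ h)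
  have hNX : N + 1 ∉ insert (j + 1) X := by
    intro h
    rcases Finset.mem_insert.1 h with h | h
    · omega
    · have := hlt _ h; omega
  have hself : X.filter (· < j + 1) = X := Finset.filter_true_of_mem hlt
  have hfil : ∀ x ∈ insert (j + 1) X,
      (insert (j + 1) X).filter (· < x) = X.filter (· < x) := by
    intro x hx
    rw [Finset.filter_insert, if_neg]
    rcases Finset.mem_insert.1 hx with rfl | h
    · omega
    · have := hlt _ h; omega
  have htop : (insert (j + 1) X).filter (· < N + 1) = insert (j + 1) X := by
    refine Finset.filter_true_of_mem fun x hx => ?_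
    rcases Finset.mem_insert.1 hx with rfl | h
    · omega
    · have := hlt _ h; omega
  unfold gapWeight
  rw [Finset.prod_insert hNX, htop,
    Finset.prod_congr rfl (fun x hx => by rw [hfil x hx] : ∀ x ∈ insert (j + 1) X,
      α ((insert (j + 1) X).filter (· < x)) x = α (X.filter (· < x)) x),
    Finset.prod_congr rfl (fun x hx => by rw [hfil x hx] : ∀ x ∈ insert (j + 1) X,
      β ((insert (j + 1) X).filter (· < x)) x = β (X.filter (· < x)) x),
    Finset.prod_insert (f := fun x => α (X.filter (· < x)) x) hjX, hself]
  ring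

theorem sup_insert_id {j : ℕ} {X : Finset ℕ} (hX : X ⊆ Finset.Icc 1 j) :
    (insert (j + 1) X).sup id = j + 1 := by
  rw [Finset.sup_insert, id]
  refine sup_eq_left.2 (Finset.sup_le fun x hx => ?_)
  have := Finset.mem_Icc.1 (hX hx)
  simp only [id]
  omega

/-- The possible minima of the block of `x` in a segmented family (`0` if `x` is in no block) when
`Y` is the set of the elements below `x` that are not block minima. -/
def gapSet (Y : Finset ℕ) (x : ℕ) : Finset ℕ :=
  if Y.sup id = 0 then {1} else insert 0 (Finset.Ioo (Y.sup id) x)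

theorem card_gapSet_insert {N j : ℕ} (hj : j < N) {X : Finset ℕ} (hX : X ⊆ Finset.Icc 1 j) :
    (gapSet (insert (j + 1) X) (N + 1)).card = N - j := by
  rw [gapSet, sup_insert_id hX, if_neg (by omega), Finset.card_insert_of_notMem (by simp),
    Nat.card_Ioo]
  omega

theorem card_gapSet_erase_insert {N j : ℕ} {X : Finset ℕ} (hX : X ⊆ Finset.Icc 1 j) :
    ((gapSet (insert (j + 1) X) (N + 1)).erase 0).card = N - 1 - j := by
  rw [gapSet, sup_insert_id hX, if_neg (by omega), Finset.erase_insert (by simp),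
    Nat.card_Ioo]
  omega

theorem sum_gapWeight_eq_stirlingBSeq (n m : ℕ) :
    ∑ X ∈ (Finset.Icc 1 (n + m)).powersetCard n,
      gapWeight (fun Y x => x - 1 - Y.card) (fun Y x => (gapSet Y x).card) (n + m) X =
      stirlingBSeq n m := by
  induction n generalizing m with
  | zero => simp [gapWeight, gapSet, stirlingBSeq]
  | succ n ih =>
    rw [sum_powersetCard_succ_Icc, stirlingBSeq, show n + 1 + m = n + (m + 1) by ring,
      Finset.sum_range_add, Finset.sum_eq_zero, zero_add]
    · refine Finset.sum_congr rfl fun j hj => ?_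
      rw [← ih, Finset.mul_sum, Finset.mul_sum]
      refine Finset.sum_congr rfl fun X hX => ?_
      obtain ⟨hX, hc⟩ := Finset.mem_powersetCard.1 hX
      have hj := Finset.mem_range.1 hj
      rw [gapWeight_insert _ _ (by omega) hX, card_gapSet_insert (by omega) hX, hc,
        show n + j + 1 - 1 - n = j by omega,
        show n + (m + 1) - (n + j) = m + 1 - j by omega]
      ring
    -- For `j < n` there is no `n`-element subset of $[j]$, so the summation effectively starts at
    -- `j = n`.
    · intro j hj
      have hj := Finset.mem_range.1 hj
      rw [Finset.powersetCard_eq_empty.2 (by simpa using hj), Finset.sum_empty]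

theorem sum_gapWeight_eq_stirlingbSeq (n m : ℕ) :
    ∑ X ∈ (Finset.Icc 1 m).powersetCard n,
      gapWeight (fun _ x => x - 1) (fun Y x => ((gapSet Y x).erase 0).card) m X =
      stirlingbSeq n m := by
  induction n generalizing m with
  | zero => simp [gapWeight, gapSet, stirlingbSeq]
  | succ n ih =>
    rw [sum_powersetCard_succ_Icc, stirlingbSeq]
    refine Finset.sum_congr rfl fun j hj => ?_
    rw [← ih, Finset.mul_sum, Finset.mul_sum]
    refine Finset.sum_congr rfl fun X hX => ?_
    obtain ⟨hX, hc⟩ := Finset.mem_powersetCard.1 hX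
    have hj := Finset.mem_range.1 hj
    rw [gapWeight_insert _ _ hj hX, card_gapSet_erase_insert hX, show j + 1 - 1 = j by omega]
    ring

/-! ### Segmented families -/

theorem sup_id_eq_zero_iff {Y : Finset ℕ} (h0 : 0 ∉ Y) : Y.sup id = 0 ↔ Y = ∅ := by
  constructor
  · intro h
    rw [Finset.eq_empty_iff_forall_notMem]
    intro y hy
    have h1 : y ≤ Y.sup id := Finset.le_sup (f := id) hy
    have h2 : y = 0 := by omega
    exact h0 (h2 ▸ hy)
  · rintro rfl
    rfl

theorem sup_id_mem {Y : Finset ℕ} (h : Y.sup id ≠ 0) : Y.sup id ∈ Y := by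
  have hY : Y.Nonempty := by
    rw [Finset.nonempty_iff_ne_empty]
    rintro rfl
    exact h rfl
  obtain ⟨y, hy, h⟩ := Finset.exists_mem_eq_sup Y hY id
  rw [h]
  exact hy

section Segmented

variable {N : ℕ} {X : Finset ℕ} {F : Finset (Finset ℕ)}

theorem Icc_sdiff_sdiff_eq_insert (hX : X ⊆ Finset.Icc 1 N) :
    Finset.Icc 1 (N + 1) \ (Finset.Icc 1 N \ X) = insert (N + 1) X := by
  ext x
  have := @hX x
  simp only [Finset.mem_sdiff, Finset.mem_Icc, Finset.mem_insert] at *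
  constructor
  · rintro ⟨h1, h2⟩
    by_cases hx : x ∈ X
    · exact Or.inr hx
    · left
      by_contra hne
      exact h2 ⟨by omega, hx⟩
  · rintro (rfl | h)
    · exact ⟨by omega, fun h => by omega⟩
    · have := this h
      exact ⟨by omega, fun h' => h'.2 h⟩

theorem gapSet_subset (hX : X ⊆ Finset.Icc 1 N) (hne : X.Nonempty) (h1 : 1 ∉ X) {x : ℕ}
    (hx : x ∈ insert (N + 1) X) :
    gapSet (X.filter (· < x)) x ⊆ insert 0 ((Finset.Icc 1 N \ X).filter (· < x)) := by
  have hxN : 1 ≤ x ∧ x ≤ N + 1 := by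
    rcases Finset.mem_insert.1 hx with rfl | h
    · omega
    · have := Finset.mem_Icc.1 (hX h); omega
  have hN : 1 ≤ N := by
    obtain ⟨y, hy⟩ := hne
    have := Finset.mem_Icc.1 (hX hy); omega
  have hx1 : x ≠ 1 := by
    rintro rfl
    rcases Finset.mem_insert.1 hx with h | h
    · omega
    · exact h1 h
  intro a ha
  simp only [Finset.mem_insert, Finset.mem_filter, Finset.mem_sdiff, Finset.mem_Icc]
  unfold gapSet at ha
  split_ifs at ha with h
  · rw [Finset.mem_singleton] at ha
    subst ha
    exact Or.inr ⟨⟨by omega, h1⟩, by omega⟩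
  · rcases Finset.mem_insert.1 ha with ha | ha
    · exact Or.inl ha
    · rw [Finset.mem_Ioo] at ha
      refine Or.inr ⟨⟨by omega, ?_⟩, ha.2⟩
      intro haX
      have : a ≤ (X.filter (· < x)).sup id :=
        Finset.le_sup (f := id) (Finset.mem_filter.2 ⟨haX, ha.2⟩)
      omega

/-- An element of `X` strictly between a block minimum and another member `x` of that block would
have to be a minimum itself. So only the largest element of `X` below `x` matters. -/
theorem isSegmented_iff_blockMin_mem (hX : X ⊆ Finset.Icc 1 N) (hne : X.Nonempty)
    (hF : IsDisjointFamily (Finset.Icc 1 (N + 1)) F)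
    (hM : familyMin F = ((Finset.Icc 1 N \ X : Finset ℕ) : Set ℕ)) :
    (IsSegmented (Finset.Icc 1 (N + 1)) F ∧ ∀ x, IsLeast (X : Set ℕ) x → SameBlock F x 1) ↔
      ∀ x ∈ insert (N + 1) X, blockMin F x ∈ gapSet (X.filter (· < x)) x := by
  have hU : 0 ∉ Finset.Icc 1 (N + 1) := by simp
  have h0 : 0 ∉ X := fun h => by have := Finset.mem_Icc.1 (hX h); omega
  have h0f : ∀ x, 0 ∉ X.filter (· < x) := fun x h => h0 (Finset.mem_filter.1 h).1
  have memM : ∀ x, x ∈ familyMin F ↔ (1 ≤ x ∧ x ≤ N) ∧ x ∉ X := by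
    intro x; rw [hM]; simp
  constructor
  · rintro ⟨hseg, hmin⟩ x hx
    unfold gapSet
    split_ifs with h
    · rw [sup_id_eq_zero_iff (h0f x), Finset.filter_eq_empty_iff] at h
      -- As `X` is nonempty and lies below `N + 1`, only the least element of `X` has no predecessor
      -- in `X`.
      have hxX : x ∈ X := by
        rcases Finset.mem_insert.1 hx with rfl | hx
        · obtain ⟨y, hy⟩ := hne
          have := Finset.mem_Icc.1 (hX hy)
          exact absurd (by omega) (h hy)
        · exact hx
      obtain ⟨B, hB, hxB, h1B⟩ := hmin x ⟨hxX, fun y hy => not_lt.1 (h hy)⟩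
      have h2 := (hF.isLeast_blockMin hB hxB).2 h1B
      have h3 := hF.blockMin_ne_zero hU hB hxB
      rw [Finset.mem_singleton]
      omega
    · have hp := sup_id_mem h
      rw [Finset.mem_filter] at hp
      by_cases hb : blockMin F x = 0
      · rw [hb]; exact Finset.mem_insert_self _ _
      · have hY : x ∈ Finset.Icc 1 (N + 1) \ (Finset.Icc 1 N \ X) := by
          rwa [Icc_sdiff_sdiff_eq_insert hX]
        have hbm := hF.blockMin_mem hM hY
        have hcov : ∃ B ∈ F, x ∈ B := by
          by_contra! hc
          exact hb (blockMin_eq_zero hc)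
        obtain ⟨B, hB, hxB⟩ := hcov
        have hl := hF.isLeast_blockMin hB hxB
        rcases Finset.mem_insert.1 hbm with hbm | hbm
        · exact absurd hbm hb
        · obtain ⟨hbm, hbx⟩ := Finset.mem_filter.1 hbm
          obtain ⟨hb1, hbX⟩ := Finset.mem_sdiff.1 hbm
          refine Finset.mem_insert_of_mem (Finset.mem_Ioo.2 ⟨?_, hbx⟩)
          by_contra! hle
          rcases hle.lt_or_eq with hlt | heq
          · have hpN := Finset.mem_Icc.1 (hX hp.1)
            have := hseg (blockMin F x) (hF.2.1 B hB hl.1) _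
              (Finset.mem_Icc.2 ⟨hpN.1, by omega⟩) x (hF.2.1 B hB hxB) hlt hp.2
              ⟨B, hB, hl.1, hxB⟩
            exact ((memM _).1 this).2 hp.1
          · exact hbX (heq ▸ hp.1)
  · intro h
    refine ⟨?_, ?_⟩
    · rintro a ha b hb c hc hab hbc ⟨B, hB, haB, hcB⟩
      have hl := hF.isLeast_blockMin hB hcB
      have hla := hl.2 haB
      have hcM : c ∉ familyMin F := by
        rintro ⟨B', hB', hc'⟩
        rw [← hF.2.2 B hB B' hB' c hcB hc'.1] at hc'
        have := hc'.2 haB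
        omega
      rw [Finset.mem_Icc] at hb hc
      have hcY : c ∈ insert (N + 1) X := by
        rw [memM] at hcM
        rw [Finset.mem_insert]
        by_contra! hcon
        exact hcM ⟨by omega, hcon.2⟩
      rw [memM]
      refine ⟨by omega, ?_⟩
      -- If `b ∈ X`, the block minimum of `c` would exceed `b`, although it is at most `a < b`.
      intro hbX
      have hbf : b ∈ X.filter (· < c) := Finset.mem_filter.2 ⟨hbX, hbc⟩
      have hle : b ≤ (X.filter (· < c)).sup id := Finset.le_sup (f := id) hbf
      have := h c hcY
      unfold gapSet at this
      rw [if_neg (by omega)] at this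
      rcases Finset.mem_insert.1 this with h3 | h3
      · exact hF.blockMin_ne_zero hU hB hcB h3
      · rw [Finset.mem_Ioo] at h3
        omega
    · intro x hx
      have h2 := h x (Finset.mem_insert_of_mem hx.1)
      have hemp : (X.filter (· < x)).sup id = 0 := by
        rw [sup_id_eq_zero_iff (h0f x), Finset.filter_eq_empty_iff]
        exact fun y hy => not_lt.2 (hx.2 hy)
      rw [gapSet, if_pos hemp, Finset.mem_singleton] at h2
      have hcov : ∃ B ∈ F, x ∈ B := by
        by_contra! hc
        rw [blockMin_eq_zero hc] at h2
        omega
      obtain ⟨B, hB, hxB⟩ := hcov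
      have hl := (hF.isLeast_blockMin hB hxB).1
      rw [h2] at hl
      exact ⟨B, hB, hxB, hl⟩

end Segmented

/-! ### The numbers of pairs -/

/-- Here `i` will be the set of non-minima, which the second component of a pair determines. -/
theorem ncard_eq_sum_card_mul_card {ι α β : Type*} (S : Finset ι) (A : ι → Finset α)
    (B : ι → Finset β) (P : Set (α × β))
    (hP : ∀ p, p ∈ P ↔ ∃ i ∈ S, p.1 ∈ A i ∧ p.2 ∈ B i)
    (hB : ∀ i ∈ S, ∀ j ∈ S, ∀ b ∈ B i, b ∈ B j → i = j) :
    P.ncard = ∑ i ∈ S, (B i).card * (A i).card := by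
  classical
  have h : P = (S.biUnion fun i => A i ×ˢ B i : Finset (α × β)) := by
    ext p
    rw [hP]
    simp only [Finset.coe_biUnion, Set.mem_iUnion, Finset.mem_coe, Finset.mem_product, exists_prop]
  rw [h, Set.ncard_coe_finset, Finset.card_biUnion]
  · refine Finset.sum_congr rfl fun i _ => ?_
    rw [Finset.card_product, mul_comm]
  · intro i hi j hj hij
    rw [Function.onFun, Finset.disjoint_left]
    intro p hp hp'
    exact hij (hB i hi j hj p.2 (Finset.mem_product.1 hp).2 (Finset.mem_product.1 hp').2)

section Pairs

variable {N : ℕ} {X : Finset ℕ} {F : Finset (Finset ℕ)}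

theorem eq_of_coe_Icc_sdiff_eq {Y : Finset ℕ} (hX : X ⊆ Finset.Icc 1 N)
    (hY : Y ⊆ Finset.Icc 1 N)
    (h : ((Finset.Icc 1 N \ X : Finset ℕ) : Set ℕ) = (Finset.Icc 1 N \ Y : Finset ℕ)) :
    X = Y := by
  rw [← Finset.sdiff_sdiff_eq_self hX, Finset.coe_inj.1 h, Finset.sdiff_sdiff_eq_self hY]

theorem setIcc_sdiff_eq (hX : X ⊆ Finset.Icc 1 N) {M : Set ℕ}
    (hM : M = ((Finset.Icc 1 N \ X : Finset ℕ) : Set ℕ)) : Set.Icc 1 N \ M = X := by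
  rw [hM, ← Finset.coe_Icc, ← Finset.coe_sdiff, Finset.sdiff_sdiff_eq_self hX]

/-- Since `0` is not an allowed value, every element is covered. -/
theorem mem_familiesWith_filter_lt (hX : X ⊆ Finset.Icc 1 N) :
    F ∈ familiesWith (Finset.Icc 1 N) (Finset.Icc 1 N \ X)
        (fun x => (Finset.Icc 1 N \ X).filter (· < x)) ↔
      IsPartitionOf F (Finset.Icc 1 N) ∧
        familyMin F = ((Finset.Icc 1 N \ X : Finset ℕ) : Set ℕ) := by
  have hU : 0 ∉ Finset.Icc 1 N := by simp
  rw [mem_familiesWith Finset.sdiff_subset hU fun x _ => Finset.subset_insert _ _,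
    isPartitionOf_iff]
  constructor
  · rintro ⟨h1, h2, h3⟩
    refine ⟨⟨h1, fun x hx => ?_⟩, h2⟩
    by_contra! hc
    by_cases hxX : x ∈ X
    · have := h3 x (by rwa [Finset.sdiff_sdiff_eq_self hX])
      rw [blockMin_eq_zero hc] at this
      simp at this
    · have : x ∈ familyMin F := by
        rw [h2]
        exact Finset.mem_coe.2 (Finset.mem_sdiff.2 ⟨hx, hxX⟩)
      obtain ⟨B, hB, h⟩ := this
      exact hc B hB h.1
  · rintro ⟨⟨h1, h2⟩, h3⟩
    refine ⟨h1, h3, fun x hx => ?_⟩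
    refine (Finset.mem_insert.1 (h1.blockMin_mem h3 hx)).resolve_left ?_
    obtain ⟨B, hB, hxB⟩ := h2 x (Finset.mem_sdiff.1 hx).1
    exact h1.blockMin_ne_zero hU hB hxB

theorem card_familiesWith_filter_lt (hX : X ⊆ Finset.Icc 1 N) :
    (familiesWith (Finset.Icc 1 N) (Finset.Icc 1 N \ X)
        (fun x => (Finset.Icc 1 N \ X).filter (· < x))).card =
      ∏ x ∈ X, (x - 1 - (X.filter (· < x)).card) := by
  rw [card_familiesWith Finset.sdiff_subset (by simp) fun x _ => Finset.subset_insert _ _,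
    Finset.sdiff_sdiff_eq_self hX]
  refine Finset.prod_congr rfl fun x hx => ?_
  have hxN := Finset.mem_Icc.1 (hX hx)
  have h : (Finset.Icc 1 N \ X).filter (· < x) = Finset.Ico 1 x \ X.filter (· < x) := by
    ext y
    simp only [Finset.mem_filter, Finset.mem_sdiff, Finset.mem_Icc, Finset.mem_Ico]
    constructor
    · rintro ⟨⟨h1, h2⟩, h3⟩
      exact ⟨⟨h1.1, h3⟩, fun h => h2 h.1⟩
    · rintro ⟨h1, h2⟩
      exact ⟨⟨⟨h1.1, by omega⟩, fun h => h2 ⟨h, h1.2⟩⟩, h1.2⟩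
  rw [h, Finset.card_sdiff_of_subset, Nat.card_Ico]
  intro y hy
  have hy := Finset.mem_filter.1 hy
  have := Finset.mem_Icc.1 (hX hy.1)
  rw [Finset.mem_Ico]
  exact ⟨this.1, hy.2⟩

theorem mem_familiesWith_gapSet (hX : X ⊆ Finset.Icc 1 N) (hne : X.Nonempty) (h1 : 1 ∉ X) :
    F ∈ familiesWith (Finset.Icc 1 (N + 1)) (Finset.Icc 1 N \ X)
        (fun x => gapSet (X.filter (· < x)) x) ↔
      IsDisjointFamily (Finset.Icc 1 (N + 1)) F ∧
        familyMin F = ((Finset.Icc 1 N \ X : Finset ℕ) : Set ℕ) ∧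
        IsSegmented (Finset.Icc 1 (N + 1)) F ∧
        ∀ x, IsLeast (X : Set ℕ) x → SameBlock F x 1 := by
  have hMU : Finset.Icc 1 N \ X ⊆ Finset.Icc 1 (N + 1) :=
    Finset.sdiff_subset.trans (Finset.Icc_subset_Icc_right (by omega))
  rw [mem_familiesWith hMU (by simp)]
  · rw [Icc_sdiff_sdiff_eq_insert hX]
    refine and_congr_right fun hF => and_congr_right fun hM => ?_
    rw [isSegmented_iff_blockMin_mem hX hne hF hM]
  · rw [Icc_sdiff_sdiff_eq_insert hX]
    exact fun x hx => gapSet_subset hX hne h1 hx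

theorem card_familiesWith_gapSet (hX : X ⊆ Finset.Icc 1 N) (hne : X.Nonempty) (h1 : 1 ∉ X) :
    (familiesWith (Finset.Icc 1 (N + 1)) (Finset.Icc 1 N \ X)
        (fun x => gapSet (X.filter (· < x)) x)).card =
      ∏ x ∈ insert (N + 1) X, (gapSet (X.filter (· < x)) x).card := by
  have hMU : Finset.Icc 1 N \ X ⊆ Finset.Icc 1 (N + 1) :=
    Finset.sdiff_subset.trans (Finset.Icc_subset_Icc_right (by omega))
  rw [card_familiesWith hMU (by simp), Icc_sdiff_sdiff_eq_insert hX]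
  rw [Icc_sdiff_sdiff_eq_insert hX]
  exact fun x hx => gapSet_subset hX hne h1 hx

theorem mem_familiesWith_gapSet_erase (hX : X ⊆ Finset.Icc 1 N) (hne : X.Nonempty)
    (h1 : 1 ∉ X) :
    F ∈ familiesWith (Finset.Icc 1 (N + 1)) (Finset.Icc 1 N \ X)
        (fun x => (gapSet (X.filter (· < x)) x).erase 0) ↔
      IsPartitionOf F (Finset.Icc 1 (N + 1)) ∧
        familyMin F = ((Finset.Icc 1 N \ X : Finset ℕ) : Set ℕ) ∧
        IsSegmented (Finset.Icc 1 (N + 1)) F ∧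
        ∀ x, IsLeast (X : Set ℕ) x → SameBlock F x 1 := by
  have hU : 0 ∉ Finset.Icc 1 (N + 1) := by simp
  have hMU : Finset.Icc 1 N \ X ⊆ Finset.Icc 1 (N + 1) :=
    Finset.sdiff_subset.trans (Finset.Icc_subset_Icc_right (by omega))
  rw [mem_familiesWith hMU hU, isPartitionOf_iff, and_assoc]
  · rw [Icc_sdiff_sdiff_eq_insert hX]
    refine and_congr_right fun hF => ?_
    rw [← and_assoc, ← and_assoc, and_comm (a := ∀ x ∈ Finset.Icc 1 (N + 1), _), and_assoc,
      and_assoc]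
    refine and_congr_right fun hM => ?_
    rw [isSegmented_iff_blockMin_mem hX hne hF hM]
    simp only [Finset.mem_erase, forall_and, ne_eq, hF.blockMin_eq_zero_iff hU]
    refine and_congr_left fun _ => ?_
    constructor
    · intro h x hx
      by_cases hxY : x ∈ insert (N + 1) X
      · by_contra! hc
        exact h x hxY hc
      · have : x ∈ familyMin F := by
          rw [hM, Finset.mem_coe]
          by_contra hc
          apply hxY
          rw [← Icc_sdiff_sdiff_eq_insert hX]
          exact Finset.mem_sdiff.2 ⟨hx, hc⟩
        obtain ⟨B, hB, h⟩ := this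
        exact ⟨B, hB, h.1⟩
    · intro h x hx hc
      rw [← Icc_sdiff_sdiff_eq_insert hX] at hx
      obtain ⟨B, hB, hxB⟩ := h x (Finset.mem_sdiff.1 hx).1
      exact hc B hB hxB
  · rw [Icc_sdiff_sdiff_eq_insert hX]
    exact fun x hx => (Finset.erase_subset _ _).trans (gapSet_subset hX hne h1 hx)

theorem card_familiesWith_gapSet_erase (hX : X ⊆ Finset.Icc 1 N) (hne : X.Nonempty)
    (h1 : 1 ∉ X) :
    (familiesWith (Finset.Icc 1 (N + 1)) (Finset.Icc 1 N \ X)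
        (fun x => (gapSet (X.filter (· < x)) x).erase 0)).card =
      ∏ x ∈ insert (N + 1) X, ((gapSet (X.filter (· < x)) x).erase 0).card := by
  have hMU : Finset.Icc 1 N \ X ⊆ Finset.Icc 1 (N + 1) :=
    Finset.sdiff_subset.trans (Finset.Icc_subset_Icc_right (by omega))
  rw [card_familiesWith hMU (by simp), Icc_sdiff_sdiff_eq_insert hX]
  rw [Icc_sdiff_sdiff_eq_insert hX]
  exact fun x hx => (Finset.erase_subset _ _).trans (gapSet_subset hX hne h1 hx)

end Pairs

theorem exists_eq_coe_Icc_sdiff {N : ℕ} {M : Set ℕ} (hM : M ⊆ Set.Icc 1 N) :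
    ∃ X ⊆ Finset.Icc 1 N, M = ((Finset.Icc 1 N \ X : Finset ℕ) : Set ℕ) := by
  classical
  refine ⟨(Finset.Icc 1 N).filter (· ∉ M), Finset.filter_subset _ _, ?_⟩
  ext x
  have := @hM x
  simp only [Finset.coe_sdiff, Finset.coe_filter, Set.mem_sdiff, Finset.coe_Icc,
    Set.mem_ofPred_eq, Finset.mem_Icc, Set.mem_Icc] at *
  tauto

theorem card_Icc_sdiff_add_card {N : ℕ} {X : Finset ℕ} (hX : X ⊆ Finset.Icc 1 N) :
    (Finset.Icc 1 N \ X).card + X.card = N := by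
  rw [Finset.card_sdiff_add_card_eq_card hX, Nat.card_Icc, Nat.add_sub_cancel]

theorem partitionPairs_eq_stirlingBSeq (n : ℕ) (hn : 1 ≤ n) (m : ℕ) :
    partitionPairs (n + m) m = stirlingBSeq n m := by
  rw [← sum_gapWeight_eq_stirlingBSeq]
  have hne : ∀ X ∈ (Finset.Icc 1 (n + m)).powersetCard n, X.Nonempty := by
    intro X hX
    rw [← Finset.card_pos, (Finset.mem_powersetCard.1 hX).2]
    exact hn
  -- The element `1` of $[N]$ is always a minimum; in the count this is the vanishing factor at `x =
  -- 1`.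
  have hone : ∀ X ⊆ Finset.Icc 1 (n + m), ∀ F ∈
      familiesWith (Finset.Icc 1 (n + m)) (Finset.Icc 1 (n + m) \ X)
        (fun x => (Finset.Icc 1 (n + m) \ X).filter (· < x)), 1 ∉ X := by
    intro X hX F hF h1
    have h := Finset.card_pos.2 ⟨F, hF⟩
    rw [card_familiesWith_filter_lt hX, Finset.prod_eq_zero h1 (by simp)] at h
    exact lt_irrefl _ h
  unfold partitionPairs
  rw [ncard_eq_sum_card_mul_card ((Finset.Icc 1 (n + m)).powersetCard n)
    (fun X => familiesWith (Finset.Icc 1 (n + m + 1)) (Finset.Icc 1 (n + m) \ X)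
      (fun x => gapSet (X.filter (· < x)) x))
    (fun X => familiesWith (Finset.Icc 1 (n + m)) (Finset.Icc 1 (n + m) \ X)
      (fun x => (Finset.Icc 1 (n + m) \ X).filter (· < x)))]
  · refine Finset.sum_congr rfl fun X hX => ?_
    obtain ⟨hXs, hc⟩ := Finset.mem_powersetCard.1 hX
    simp only [gapWeight]
    rw [card_familiesWith_filter_lt hXs]
    -- If `1 ∈ X`, both sides vanish through the factor at `1`, so the count of segmented families
    -- is not needed.
    by_cases h1 : 1 ∈ X
    · rw [Finset.prod_eq_zero h1 (by simp), zero_mul, zero_mul]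
    · rw [card_familiesWith_gapSet hXs (hne X hX) h1]
  · rintro ⟨F₀, F₁⟩
    simp only [Set.mem_ofPred_eq, exists_isPartitionOf_iff]
    constructor
    · rintro ⟨hF₁, hc₁, hF₀, hc₀, hseg, hmin, hleast⟩
      have hF₁' := (isPartitionOf_iff.1 hF₁).1
      obtain ⟨X, hX, hM⟩ := exists_eq_coe_Icc_sdiff
        (hF₁'.familyMin_subset.trans (Finset.coe_Icc _ _).subset)
      have hcard := card_Icc_sdiff_add_card hX
      rw [← hF₁'.card_eq (by simp) hM, hc₁] at hcard
      have hXm := Finset.mem_powersetCard.2 ⟨hX, (by omega : X.card = n)⟩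
      have hmem := (mem_familiesWith_filter_lt hX).2 ⟨hF₁, hM⟩
      rw [setIcc_sdiff_eq hX hM] at hleast
      exact ⟨X, hXm, (mem_familiesWith_gapSet hX (hne X hXm) (hone X hX _ hmem)).2
        ⟨hF₀, hmin ▸ hM, hseg, hleast⟩, hmem⟩
    · rintro ⟨X, hXm, h₀, h₁⟩
      obtain ⟨hX, hXc⟩ := Finset.mem_powersetCard.1 hXm
      have h1 := hone X hX _ h₁
      rw [mem_familiesWith_filter_lt hX] at h₁
      rw [mem_familiesWith_gapSet hX (hne X hXm) h1] at h₀
      have hcard := card_Icc_sdiff_add_card hX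
      refine ⟨h₁.1, ?_, h₀.1, ?_, h₀.2.2.1, h₁.2.trans h₀.2.1.symm, ?_⟩
      · rw [(isPartitionOf_iff.1 h₁.1).1.card_eq (by simp) h₁.2]
        omega
      · rw [h₀.1.card_eq (by simp) h₀.2.1]
        omega
      · rw [setIcc_sdiff_eq hX h₁.2]
        exact h₀.2.2.2
  · intro X hX Y hY F hFX hFY
    have hX := (Finset.mem_powersetCard.1 hX).1
    have hY := (Finset.mem_powersetCard.1 hY).1
    rw [mem_familiesWith_filter_lt hX] at hFX
    rw [mem_familiesWith_filter_lt hY] at hFY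
    exact eq_of_coe_Icc_sdiff_eq hX hY (hFX.2.symm.trans hFY.2)

theorem permutationPairs_eq_stirlingbSeq (n : ℕ) (hn : 1 ≤ n) (m : ℕ) :
    permutationPairs m ((m : ℤ) - n) = stirlingbSeq n m := by
  classical
  rw [← sum_gapWeight_eq_stirlingbSeq]
  have hne : ∀ X ∈ (Finset.Icc 1 m).powersetCard n, X.Nonempty := by
    intro X hX
    rw [← Finset.card_pos, (Finset.mem_powersetCard.1 hX).2]
    exact hn
  have hcardσ : ∀ X ⊆ Finset.Icc 1 m, (Finset.univ.filter fun σ : Equiv.Perm (Fin m) =>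
      lmin σ = ((Finset.Icc 1 m \ X : Finset ℕ) : Set ℕ)).card = ∏ x ∈ X, (x - 1) := by
    intro X hX
    rw [← card_perm_lmin hX, ← Set.ncard_coe_finset, Finset.coe_filter_univ]
  -- The value `1` is always a left-to-right minimum, again seen from a vanishing factor.
  have hone : ∀ X ⊆ Finset.Icc 1 m, ∀ σ : Equiv.Perm (Fin m),
      lmin σ = ((Finset.Icc 1 m \ X : Finset ℕ) : Set ℕ) → 1 ∉ X := by
    intro X hX σ hσ h1
    have h := hcardσ X hX
    rw [Finset.prod_eq_zero h1 (by simp), Finset.card_eq_zero] at h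
    exact Finset.notMem_empty σ (h ▸ Finset.mem_filter.2 ⟨Finset.mem_univ σ, hσ⟩)
  unfold permutationPairs
  rw [ncard_eq_sum_card_mul_card ((Finset.Icc 1 m).powersetCard n)
    (fun X => familiesWith (Finset.Icc 1 (m + 1)) (Finset.Icc 1 m \ X)
      (fun x => (gapSet (X.filter (· < x)) x).erase 0))
    (fun X => Finset.univ.filter fun σ : Equiv.Perm (Fin m) =>
      lmin σ = ((Finset.Icc 1 m \ X : Finset ℕ) : Set ℕ))]
  · refine Finset.sum_congr rfl fun X hX => ?_
    obtain ⟨hXs, hc⟩ := Finset.mem_powersetCard.1 hX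
    simp only [gapWeight]
    rw [hcardσ X hXs]
    by_cases h1 : 1 ∈ X
    · rw [Finset.prod_eq_zero h1 (by simp), zero_mul, zero_mul]
    · rw [card_familiesWith_gapSet_erase hXs (hne X hX) h1]
  · rintro ⟨F, σ⟩
    simp only [Set.mem_ofPred_eq, Finset.mem_filter, Finset.mem_univ, true_and]
    constructor
    · rintro ⟨hcσ, hF, hc, hseg, hmin, hleast⟩
      obtain ⟨X, hX, hM⟩ := exists_eq_coe_Icc_sdiff (lmin_subset σ)
      have hcard := card_Icc_sdiff_add_card hX
      rw [hM, Set.ncard_coe_finset] at hcσ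
      have hXm := Finset.mem_powersetCard.2 ⟨hX, (by omega : X.card = n)⟩
      rw [setIcc_sdiff_eq hX hM] at hleast
      exact ⟨X, hXm, (mem_familiesWith_gapSet_erase hX (hne X hXm) (hone X hX σ hM)).2
        ⟨hF, hmin ▸ hM, hseg, hleast⟩, hM⟩
    · rintro ⟨X, hXm, h₀, h₁⟩
      obtain ⟨hX, hXc⟩ := Finset.mem_powersetCard.1 hXm
      rw [mem_familiesWith_gapSet_erase hX (hne X hXm) (hone X hX σ h₁)] at h₀
      have hcard := card_Icc_sdiff_add_card hX
      refine ⟨?_, h₀.1, ?_, h₀.2.2.1, h₁.trans h₀.2.1.symm, ?_⟩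
      · rw [h₁, Set.ncard_coe_finset]
        omega
      · rw [(isPartitionOf_iff.1 h₀.1).1.card_eq (by simp) h₀.2.1]
        omega
      · rw [setIcc_sdiff_eq hX h₁]
        exact h₀.2.2.2
  · intro X hX Y hY σ hσX hσY
    have hX := (Finset.mem_powersetCard.1 hX).1
    have hY := (Finset.mem_powersetCard.1 hY).1
    exact eq_of_coe_Icc_sdiff_eq hX hY
      ((Finset.mem_filter.1 hσX).2.symm.trans (Finset.mem_filter.1 hσY).2)

theorem corollary2 (n : ℕ) (hn : 1 ≤ n) (m : ℕ) :
    stirlingB (fun _ : Fin n => 3) m = (partitionPairs (n + m) m : ℚ) ∧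
      stirlingb (fun _ : Fin n => 3) m = (permutationPairs m ((m : ℤ) - (n : ℤ)) : ℚ) := by
  rw [stirlingB_three n hn, stirlingb_three n hn, partitionPairs_eq_stirlingBSeq n hn,
    permutationPairs_eq_stirlingbSeq n hn]
  exact ⟨rfl, rfl⟩
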